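/- Let $\Phi_F>0$ and let $K\in C^2(\mathbb R)$ have bounded derivatives $K',K''$ on $\mathbb R$, with $K>0$ on $[0,\Phi_F]$. For $0<T\le+\infty$ and an initial datum $Q_{\rm init}:[0,1]\to\mathbb R$, a classical solution on $[0,T)$ is a pair $(Q,N)$ with $Q\in C^1([0,T)\times[0,1])$ non-decreasing in $\eta$ and $N\in C([0,T))$ positive, such that for $\tau\in[0,T)$ $$\partial_\tau Q+\partial_\eta Q=\frac1{N(\tau)}+K(Q)\ \ (0<\eta<1),\qquad Q(\tau,0)=0,\qquad \frac1{N(\tau)}=\partial_\eta Q(\tau,1)-K(\Phi_F),$$ $Q(0,\eta)=Q_{\rm init}(\eta)$ for $\eta\in[0,1]$, and $K(\Phi_F)<\partial_\eta Q(\tau,1)<+\infty$ (derivatives at boundary points are one-sided). Theorem. Assume that $K'\le0$ on $[0,\Phi_F]$; that $Q_{\rm init}\in C^1([0,1])$ is non-decreasing with $Q_{\rm init}(0)=0$, $Q_{\rm init}(1)=\Phi_F$, $Q_{\rm init}'(1)>K(\Phi_F)$ and $Q_{\rm init}'(1)-Q_{\rm init}'(0)=K(\Phi_F)-K(0)$;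 and that $H_{\rm init}(\eta):=Q_{\rm init}'(\eta)-K(Q_{\rm init}(\eta))>0$ for all $\eta\in[0,1]$. Then there exists a unique global classical solution $(Q,N)$, that is, a classical solution on $[0,+\infty)$; moreover every classical solution on an interval $[0,T)$, $0<T\le+\infty$, with the same initial datum is its restriction to $[0,T)$. Furthermore $$0<\frac1{\max_{\eta\in[0,1]}H_{\rm init}(\eta)}\le N(\tau)\le\frac1{\min_{\eta\in[0,1]}H_{\rm init}(\eta)}<+\infty\qquad\text{for all }\tau\ge0.$$ -/

import Mathlib

open Set

noncomputable section

namespace PulseCoupled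

/-- Standing assumptions on the phase response function `K : ℝ → ℝ` with firing phase `ΦF`:
`K` is of class `C²` on `ℝ`, `K'` and `K''` are bounded on `ℝ`, and `K > 0` on `[0, ΦF]`. -/
structure IsPhaseResponse (K : ℝ → ℝ) (ΦF : ℝ) : Prop where
  contDiff : ContDiff ℝ 2 K
  bounded_deriv : ∃ C : ℝ, ∀ φ : ℝ, |deriv K φ| ≤ C
  bounded_deriv2 : ∃ C : ℝ, ∀ φ : ℝ, |deriv (deriv K) φ| ≤ C
  pos : ∀ φ ∈ Icc (0 : ℝ) ΦF, 0 < K φ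

/-- The derivative of a function of `η ∈ [0,1]` (one-sided at the two end points). -/
def dEta (f : ℝ → ℝ) (η : ℝ) : ℝ := derivWithin f (Icc (0 : ℝ) 1) η

/-- Initial data `Qinit : [0,1] → ℝ`, of class `C¹`, non-decreasing, joining `0` to `ΦF`,
and compatible to first order with the boundary conditions.  Only the values of `Qinit` on
`[0,1]` matter. -/
structure IsCompatibleInitialData (K : ℝ → ℝ) (ΦF : ℝ) (Qinit : ℝ → ℝ) : Prop where
  contDiffOn : ContDiffOn ℝ 1 Qinit (Icc (0 : ℝ) 1)
  mono : MonotoneOn Qinit (Icc (0 : ℝ) 1)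
  left : Qinit 0 = 0
  right : Qinit 1 = ΦF
  slope : K ΦF < dEta Qinit 1
  compat : dEta Qinit 1 - dEta Qinit 0 = K ΦF - K 0

/-- `Hinit(η) = ∂_η Qinit(η) - K(Qinit(η))`. -/
def Hinit (K : ℝ → ℝ) (Qinit : ℝ → ℝ) (η : ℝ) : ℝ := dEta Qinit η - K (Qinit η)

/-- The time interval `[0, T)`, where `T = +∞` is allowed. -/
def timeInterval (T : EReal) : Set ℝ := {τ : ℝ | 0 ≤ τ ∧ (τ : EReal) < T}

/-- `(Q, N)` is a classical solution on `[0, T)`, `0 < T ≤ +∞`, with initial data `Qinit`, of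
`∂_τ Q + ∂_η Q = 1 / N(τ) + K(Q)`, `Q(τ, 0) = 0`, `1 / N(τ) = ∂_η Q(τ, 1) - K(ΦF)`,
under the constraint `K(ΦF) < ∂_η Q(τ, 1)`.
Only the values of `Q` on `[0, T) × [0, 1]` and of `N` on `[0, T)` matter; derivatives at the
boundary of the domain are one-sided. -/
structure IsClassicalSolution (K : ℝ → ℝ) (ΦF : ℝ) (Qinit : ℝ → ℝ) (T : EReal)
    (Q : ℝ → ℝ → ℝ) (N : ℝ → ℝ) : Prop where
  time_pos : 0 < T
  contDiffOn : ContDiffOn ℝ 1 (fun p : ℝ × ℝ => Q p.1 p.2) (timeInterval T ×ˢ Icc (0 : ℝ) 1)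
  mono : ∀ τ ∈ timeInterval T, MonotoneOn (Q τ) (Icc (0 : ℝ) 1)
  rate_cont : ContinuousOn N (timeInterval T)
  rate_pos : ∀ τ ∈ timeInterval T, 0 < N τ
  transport : ∀ τ ∈ timeInterval T, ∀ η ∈ Ioo (0 : ℝ) 1,
    derivWithin (fun s => Q s η) (timeInterval T) τ + dEta (Q τ) η = 1 / N τ + K (Q τ η)
  inflow : ∀ τ ∈ timeInterval T, Q τ 0 = 0
  rate_eq : ∀ τ ∈ timeInterval T, 1 / N τ = dEta (Q τ) 1 - K ΦF
  initial : ∀ η ∈ Icc (0 : ℝ) 1, Q 0 η = Qinit η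
  constraint : ∀ τ ∈ timeInterval T, K ΦF < dEta (Q τ) 1

end PulseCoupled

end

open Filter Topology
open scoped NNReal

noncomputable section

namespace PulseCoupled

/-! Put `P(τ) = ∫₀^τ 1/N`. Along a characteristic `τ - η = s`, the quantity `z = Q - P` solves `z' =
K(z + P)`. At the outlet, transport and the law for `N` combine into `∂_τ Q(τ,1) = K(Q(τ,1)) -
K(ΦF)`, so `Q(τ,1) = ΦF` for all time. Hence `P(τ) = ΦF - z(τ)` on the characteristic leaving at
time `τ`. This characteristic starts from the datum if `τ ≤ 1`, and from `z = -P(τ-1)` at the inlet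
if `τ ≥ 1`. The problem is thus a fixed-point equation for `P` with delay one.

On continuous functions with weight `exp(-(5L+5)τ)` the fixed-point map contracts by `1/2`
(`abs_sub_le_half_of_trajectories`). The same estimate gives existence (`exists_fixedPoint_rateMap`)
and uniqueness (`primitive_unique`), with no smallness or blow-up alternative. The fixed point is
`C¹` by the method of steps, the compatibility condition providing the junction at time `0`
(`contDiff_fixedPoint`).

The bounds, and the positivity of `1/N`, come from `H = ∂_η Q - K(Q)`. Along characteristics `H' =
K'(Q)(H - 1/N)`, and `H = 1/N` at both inlet and outlet. As `K' ≤ 0`, each `1/N(τ)` is the final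
value of a quantity relaxing towards `1/N`, started from `Hinit` or from an earlier `1/N`. The
maximum principle `le_of_relaxation` then confines `1/N` between the extrema of `Hinit`.

Existence is carried out for a bounded modification of `K`, nonincreasing on the whole line.
Positivity of `1/N` makes `Q` increasing in `η`, so `Q` stays in `[0, ΦF]`, where the modification
equals `K`. -/

/-! ### Global integral curves and linear equations -/

theorem exists_global_integral_curve {v : ℝ → ℝ → ℝ} {L B : ℝ≥0}
    (hL : ∀ t, LipschitzWith L (v t)) (hc : ∀ x, Continuous fun t => v t x)
    (hB : ∀ t x, |v t x| ≤ B) (t₀ x₀ : ℝ) :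
    ∃ z : ℝ → ℝ, z t₀ = x₀ ∧ ∀ t, HasDerivAt z (v t (z t)) t := by
  have loc : ∀ n : ℕ, ∃ z : ℝ → ℝ, z t₀ = x₀ ∧
      ∀ t ∈ Ioo (t₀ - (n + 1)) (t₀ + (n + 1)), HasDerivAt z (v t (z t)) t := by
    intro n
    have hmem : t₀ ∈ Icc (t₀ - (n + 1 : ℝ)) (t₀ + (n + 1)) := by
      constructor <;> linarith [(Nat.cast_nonneg n : (0 : ℝ) ≤ n)]
    -- At speed at most `B`, no curve leaves the ball of radius `B * (n + 1)` within time `n + 1`.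
    have pl : IsPicardLindelof v ⟨t₀, hmem⟩ x₀ (B * (n + 1)) 0 B L :=
      { lipschitzOnWith := fun t _ => (hL t).lipschitzOnWith
        continuousOn := fun x _ => (hc x).continuousOn
        norm_le := fun t _ x _ => hB t x
        mul_max_le := by simp }
    obtain ⟨z, hz, hz'⟩ := pl.exists_eq_forall_mem_Icc_hasDerivWithinAt₀
    exact ⟨z, hz, fun t ht => (hz' t (Ioo_subset_Icc_self ht)).hasDerivAt (Icc_mem_nhds ht.1 ht.2)⟩
  choose z hz hz' using loc
  have agree : ∀ m n : ℕ, m ≤ n → ∀ t, |t - t₀| < m + 1 → z m t = z n t := by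
    intro m n hmn t ht
    have hmn' : (m : ℝ) ≤ n := by exact_mod_cast hmn
    have hm : (0 : ℝ) ≤ m := Nat.cast_nonneg m
    rw [abs_lt] at ht
    refine ODE_solution_unique_of_mem_Ioo (v := v) (s := fun _ => univ) (K := L)
      (a := t₀ - (m + 1)) (b := t₀ + (m + 1)) (t₀ := t₀)
      (fun t _ => (hL t).lipschitzOnWith) ⟨by linarith, by linarith⟩
      (fun t ht => ⟨hz' m t ht, trivial⟩)
      (fun t ht => ⟨hz' n t ⟨by linarith [ht.1], by linarith [ht.2]⟩, trivial⟩)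
      (by rw [hz, hz]) ⟨by linarith, by linarith⟩
  refine ⟨fun t => z ⌈|t - t₀|⌉₊ t, hz _, fun t => ?_⟩
  -- The extra `1` lets a single local curve serve on a whole neighbourhood of `t`.
  set N := ⌈|t - t₀|⌉₊ + 1 with hN
  have key : ∀ s, |s - t₀| ≤ N → z ⌈|s - t₀|⌉₊ s = z N s := fun s hs =>
    agree _ _ (Nat.ceil_le.2 hs) s (by linarith [Nat.le_ceil |s - t₀|])
  have ht : |t - t₀| < N := by
    rw [hN]; push_cast; linarith [Nat.le_ceil |t - t₀|]
  have hev : (fun s => z ⌈|s - t₀|⌉₊ s) =ᶠ[𝓝 t] z N := by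
    have : ∀ᶠ s in 𝓝 t, |s - t₀| < N :=
      (continuous_abs.comp (continuous_id.sub continuous_const)).continuousAt.eventually_lt
        continuousAt_const ht
    exact this.mono fun s hs => key s hs.le
  refine HasDerivAt.congr_of_eventuallyEq ?_ hev
  beta_reduce
  rw [key t ht.le]
  rw [abs_lt] at ht
  exact hz' N t ⟨by linarith, by linarith⟩

theorem eq_mul_exp_integral_of_hasDerivAt {u c : ℝ → ℝ} (hc : Continuous c)
    (hu : ∀ t, HasDerivAt u (c t * u t) t) (t₀ t : ℝ) :
    u t = u t₀ * Real.exp (∫ r in t₀..t, c r) := by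
  have hI : ∀ t, HasDerivAt (fun t => ∫ r in t₀..t, c r) (c t) t := fun t =>
    intervalIntegral.integral_hasDerivAt_right (hc.intervalIntegrable _ _)
      hc.aestronglyMeasurable.stronglyMeasurableAtFilter hc.continuousAt
  have hw : ∀ t, HasDerivAt (fun t => u t * Real.exp (-∫ r in t₀..t, c r)) 0 t := by
    intro t
    exact ((hu t).mul (hI t).neg.exp).congr_deriv (by ring)
  have := is_const_of_deriv_eq_zero (fun t => (hw t).differentiableAt) (fun t => (hw t).deriv) t t₀
  simp only [intervalIntegral.integral_same, neg_zero, Real.exp_zero, mul_one] at this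
  rw [← this, mul_assoc, ← Real.exp_add]
  simp

theorem lipschitzWith_comp_add_const {K : ℝ → ℝ} {L : ℝ≥0} (hK : LipschitzWith L K) (c : ℝ) :
    LipschitzWith L fun y => K (y + c) :=
  LipschitzWith.of_dist_le_mul fun x y => by
    simpa only [dist_add_right] using hK.dist_le_mul (x + c) (y + c)

/-! ### Divided differences and the flow of `z' = K(z + P)` -/

/-- The divided difference of `K`, extended by the derivative on the diagonal. -/
def divDiff (K : ℝ → ℝ) (a b : ℝ) : ℝ := ∫ θ in (0 : ℝ)..1, deriv K (b + θ * (a - b))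

theorem divDiff_self (K : ℝ → ℝ) (a : ℝ) : divDiff K a a = deriv K a := by
  simp [divDiff]

theorem continuous_divDiff {K : ℝ → ℝ} (hK : ContDiff ℝ 1 K) :
    Continuous fun p : ℝ × ℝ => divDiff K p.1 p.2 := by
  have h := hK.continuous_deriv le_rfl
  unfold divDiff
  exact intervalIntegral.continuous_parametric_intervalIntegral_of_continuous' (by fun_prop) _ _

theorem sub_eq_divDiff_mul {K : ℝ → ℝ} (hK : ContDiff ℝ 1 K) (a b : ℝ) :
    K a - K b = divDiff K a b * (a - b) := by
  have h := hK.continuous_deriv le_rfl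
  have hd : ∀ θ ∈ uIcc (0 : ℝ) 1, HasDerivAt (fun θ : ℝ => K (b + θ * (a - b)))
      (deriv K (b + θ * (a - b)) * (a - b)) θ := by
    intro θ _
    have h1 : HasDerivAt (fun θ : ℝ => b + θ * (a - b)) (a - b) θ := by
      simpa using ((hasDerivAt_id θ).mul_const (a - b)).const_add b
    exact ((hK.differentiable one_ne_zero _).hasDerivAt).comp θ h1
  have := intervalIntegral.integral_eq_sub_of_hasDerivAt hd
    (Continuous.intervalIntegrable (by fun_prop) _ _)
  rw [intervalIntegral.integral_mul_const] at this
  simp only [one_mul, add_sub_cancel, zero_mul, add_zero] at this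
  exact this.symm

/-- A bounded Lipschitz function of class `C¹`. -/
structure IsTame (K : ℝ → ℝ) (L B : ℝ≥0) : Prop where
  contDiff : ContDiff ℝ 1 K
  lipschitz : LipschitzWith L K
  bounded : ∀ x, |K x| ≤ B

/-- The solution of `z' = K (z + P t)` with `z t₀ = x`. -/
def flow (K P : ℝ → ℝ) (t₀ x : ℝ) : ℝ → ℝ :=
  Classical.epsilon fun z : ℝ → ℝ => z t₀ = x ∧ ∀ t, HasDerivAt z (K (z t + P t)) t

section flow

variable {K P : ℝ → ℝ} {L B : ℝ≥0}

theorem flow_spec (hK : IsTame K L B) (hP : Continuous P) (t₀ x : ℝ) :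
    flow K P t₀ x t₀ = x ∧
      ∀ t, HasDerivAt (flow K P t₀ x) (K (flow K P t₀ x t + P t)) t := by
  refine Classical.epsilon_spec (p := fun z : ℝ → ℝ => z t₀ = x ∧
    ∀ t, HasDerivAt z (K (z t + P t)) t) ?_
  have hKc := hK.contDiff.continuous
  refine exists_global_integral_curve (v := fun t y => K (y + P t)) (L := L) (B := B)
    (fun t => ?_) (fun x => by fun_prop) (fun t x => hK.bounded _) t₀ x
  exact lipschitzWith_comp_add_const hK.lipschitz (P t)

theorem flow_self (hK : IsTame K L B) (hP : Continuous P) (t₀ x : ℝ) :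
    flow K P t₀ x t₀ = x := (flow_spec hK hP t₀ x).1

theorem hasDerivAt_flow (hK : IsTame K L B) (hP : Continuous P) (t₀ x t : ℝ) :
    HasDerivAt (flow K P t₀ x) (K (flow K P t₀ x t + P t)) t := (flow_spec hK hP t₀ x).2 t

theorem continuous_flow_time (hK : IsTame K L B) (hP : Continuous P) (t₀ x : ℝ) :
    Continuous (flow K P t₀ x) :=
  continuous_iff_continuousAt.2 fun t => (hasDerivAt_flow hK hP t₀ x t).continuousAt

theorem flow_flow (hK : IsTame K L B) (hP : Continuous P) (t₀ x t₁ : ℝ) :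
    flow K P t₁ (flow K P t₀ x t₁) = flow K P t₀ x := by
  refine ODE_solution_unique_univ (v := fun t y => K (y + P t)) (s := fun _ => univ) (K := L)
    (t₀ := t₁) (fun t => ?_) (fun t => ⟨hasDerivAt_flow hK hP _ _ t, trivial⟩)
    (fun t => ⟨hasDerivAt_flow hK hP _ _ t, trivial⟩) (flow_self hK hP _ _)
  exact (lipschitzWith_comp_add_const hK.lipschitz (P t)).lipschitzOnWith

/-- The amplification factor between the trajectories issued at time `0` from `x` and `y`. -/
def flowRatio (K P : ℝ → ℝ) (t x y : ℝ) : ℝ :=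
  Real.exp (∫ r in (0 : ℝ)..t, divDiff K (flow K P 0 x r + P r) (flow K P 0 y r + P r))

theorem flowRatio_pos (K P : ℝ → ℝ) (t x y : ℝ) : 0 < flowRatio K P t x y := Real.exp_pos _

theorem flowRatio_zero (K P : ℝ → ℝ) (x y : ℝ) : flowRatio K P 0 x y = 1 := by simp [flowRatio]

/-- The difference of two trajectories solves a linear equation whose coefficient is the divided
difference of `K`. The identity is exact, so continuity and differentiability of the flow in its
initial value reduce to bounds on `flowRatio` and its continuity. -/
theorem flow_sub_flow (hK : IsTame K L B) (hP : Continuous P) (t x y : ℝ) :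
    flow K P 0 x t - flow K P 0 y t = (x - y) * flowRatio K P t x y := by
  have hc : Continuous fun r => divDiff K (flow K P 0 x r + P r) (flow K P 0 y r + P r) :=
    (continuous_divDiff hK.contDiff).comp
      (((continuous_flow_time hK hP 0 x).add hP).prodMk ((continuous_flow_time hK hP 0 y).add hP))
  have := eq_mul_exp_integral_of_hasDerivAt
    (u := fun t => flow K P 0 x t - flow K P 0 y t) hc (fun t => ?_) 0 t
  · simpa only [flow_self hK hP, flowRatio] using this
  · refine ((hasDerivAt_flow hK hP 0 x t).sub (hasDerivAt_flow hK hP 0 y t)).congr_deriv ?_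
    rw [sub_eq_divDiff_mul hK.contDiff]
    ring

theorem abs_divDiff_le (hK : IsTame K L B) (a b : ℝ) : |divDiff K a b| ≤ L := by
  have := intervalIntegral.norm_integral_le_of_norm_le_const (a := (0 : ℝ)) (b := 1) (C := L)
    (f := fun θ => deriv K (b + θ * (a - b))) fun θ _ =>
      norm_deriv_le_of_lipschitz hK.lipschitz
  simpa [divDiff] using this

theorem abs_integral_divDiff_le (hK : IsTame K L B) (f g : ℝ → ℝ) (t : ℝ) :
    |∫ r in (0 : ℝ)..t, divDiff K (f r) (g r)| ≤ L * |t| := by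
  simpa using intervalIntegral.norm_integral_le_of_norm_le_const (a := (0 : ℝ)) (b := t) (C := L)
    (f := fun r => divDiff K (f r) (g r)) fun r _ => abs_divDiff_le hK _ _

theorem flowRatio_le (hK : IsTame K L B) (t x y : ℝ) :
    flowRatio K P t x y ≤ Real.exp (L * |t|) :=
  Real.exp_le_exp.2 (abs_le.1 (abs_integral_divDiff_le hK _ _ t)).2

theorem le_flowRatio (hK : IsTame K L B) (t x y : ℝ) :
    Real.exp (-(L * |t|)) ≤ flowRatio K P t x y :=
  Real.exp_le_exp.2 (abs_le.1 (abs_integral_divDiff_le hK _ _ t)).1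

theorem continuous_flow (hK : IsTame K L B) (hP : Continuous P) :
    Continuous fun p : ℝ × ℝ => flow K P 0 p.2 p.1 := by
  rw [continuous_iff_continuousAt]
  rintro ⟨t, x⟩
  have h1 : Tendsto (fun p : ℝ × ℝ => (p.2 - x) * flowRatio K P p.1 p.2 x) (𝓝 (t, x)) (𝓝 0) := by
    refine squeeze_zero_norm (a := fun p : ℝ × ℝ => |p.2 - x| * Real.exp (L * |p.1|))
      (fun p => ?_) ?_
    · rw [norm_mul, Real.norm_eq_abs, Real.norm_eq_abs, abs_of_pos (flowRatio_pos _ _ _ _ _)]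
      exact mul_le_mul_of_nonneg_left (flowRatio_le hK _ _ _) (abs_nonneg _)
    · have : Continuous fun p : ℝ × ℝ => |p.2 - x| * Real.exp (L * |p.1|) := by fun_prop
      simpa using this.tendsto (t, x)
  have h2 : Tendsto (fun p : ℝ × ℝ => flow K P 0 x p.1) (𝓝 (t, x)) (𝓝 (flow K P 0 x t)) :=
    ((continuous_flow_time hK hP 0 x).comp continuous_fst).tendsto (t, x)
  have h3 := h1.add h2
  rw [zero_add] at h3
  refine h3.congr fun p => ?_
  rw [← flow_sub_flow hK hP]
  ring

theorem continuous_flowRatio (hK : IsTame K L B) (hP : Continuous P) :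
    Continuous fun p : ℝ × ℝ × ℝ => flowRatio K P p.1 p.2.1 p.2.2 := by
  unfold flowRatio
  refine Real.continuous_exp.comp ?_
  refine intervalIntegral.continuous_parametric_intervalIntegral_of_continuous
    (f := fun (p : ℝ × ℝ × ℝ) r => divDiff K (flow K P 0 p.2.1 r + P r) (flow K P 0 p.2.2 r + P r))
    ?_ continuous_fst
  have hf := continuous_flow hK hP
  refine (continuous_divDiff hK.contDiff).comp (Continuous.prodMk ?_ ?_)
  · exact (hf.comp (continuous_snd.prodMk (continuous_fst.comp (continuous_snd.comp
      continuous_fst)))).add (hP.comp continuous_snd)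
  · exact (hf.comp (continuous_snd.prodMk (continuous_snd.comp (continuous_snd.comp
      continuous_fst)))).add (hP.comp continuous_snd)

/-- By `flow_sub_flow` the difference quotient equals `flowRatio K P t y x`, which is continuous up
to the diagonal. -/
theorem hasDerivAt_flow_initial (hK : IsTame K L B) (hP : Continuous P) (t x : ℝ) :
    HasDerivAt (fun y => flow K P 0 y t) (flowRatio K P t x x) x := by
  rw [hasDerivAt_iff_tendsto_slope]
  have hc : Continuous fun y => flowRatio K P t y x :=
    (continuous_flowRatio hK hP).comp (by fun_prop : Continuous fun y : ℝ => (t, y, x))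
  refine ((hc.tendsto x).mono_left nhdsWithin_le_nhds).congr' ?_
  filter_upwards [self_mem_nhdsWithin] with y hy
  have hy' : y - x ≠ 0 := sub_ne_zero.2 hy
  rw [slope_def_field, flow_sub_flow hK hP]
  field_simp

end flow

/-! ### Continuous partial derivatives, and gluing of two branches at `0` -/

section calculus

theorem hasStrictFDerivAt_of_continuous_partials {f f₁ f₂ : ℝ → ℝ → ℝ}
    (h₁ : ∀ x y, HasDerivAt (fun x => f x y) (f₁ x y) x)
    (h₂ : ∀ x y, HasDerivAt (fun y => f x y) (f₂ x y) y)
    (c₁ : Continuous fun p : ℝ × ℝ => f₁ p.1 p.2) (c₂ : Continuous fun p : ℝ × ℝ => f₂ p.1 p.2)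
    (p : ℝ × ℝ) :
    HasStrictFDerivAt (fun p : ℝ × ℝ => f p.1 p.2)
      ((ContinuousLinearMap.toSpanSingleton ℝ (f₁ p.1 p.2)).coprod
        (ContinuousLinearMap.toSpanSingleton ℝ (f₂ p.1 p.2))) p :=
  hasStrictFDerivAt_uncurry_coprod (u := p) (f := f)
    (f₁ := fun x y => ContinuousLinearMap.toSpanSingleton ℝ (f₁ x y))
    (f₂ := fun x y => ContinuousLinearMap.toSpanSingleton ℝ (f₂ x y))
    (Eventually.of_forall fun v => (h₁ v.1 v.2).hasFDerivAt)
    (Eventually.of_forall fun v => (h₂ v.1 v.2).hasFDerivAt)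
    ((ContinuousLinearMap.toSpanSingletonCLE (𝕜 := ℝ) (E := ℝ)).continuous.comp c₁).continuousAt
    ((ContinuousLinearMap.toSpanSingletonCLE (𝕜 := ℝ) (E := ℝ)).continuous.comp c₂).continuousAt

theorem contDiff_of_continuous_partials {f f₁ f₂ : ℝ → ℝ → ℝ}
    (h₁ : ∀ x y, HasDerivAt (fun x => f x y) (f₁ x y) x)
    (h₂ : ∀ x y, HasDerivAt (fun y => f x y) (f₂ x y) y)
    (c₁ : Continuous fun p : ℝ × ℝ => f₁ p.1 p.2) (c₂ : Continuous fun p : ℝ × ℝ => f₂ p.1 p.2) :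
    ContDiff ℝ 1 fun p : ℝ × ℝ => f p.1 p.2 := by
  refine contDiff_one_iff_hasFDerivAt.2 ⟨_, ?_, fun p =>
    (hasStrictFDerivAt_of_continuous_partials h₁ h₂ c₁ c₂ p).hasFDerivAt⟩
  have e := (ContinuousLinearMap.toSpanSingletonCLE (𝕜 := ℝ) (E := ℝ)).continuous
  exact (e.comp c₁).continuousLinearMapCoprod (e.comp c₂)

theorem hasDerivAt_comp_of_continuous_partials {f f₁ f₂ : ℝ → ℝ → ℝ}
    (h₁ : ∀ x y, HasDerivAt (fun x => f x y) (f₁ x y) x)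
    (h₂ : ∀ x y, HasDerivAt (fun y => f x y) (f₂ x y) y)
    (c₁ : Continuous fun p : ℝ × ℝ => f₁ p.1 p.2) (c₂ : Continuous fun p : ℝ × ℝ => f₂ p.1 p.2)
    {α β : ℝ → ℝ} {a b t : ℝ} (hα : HasDerivAt α a t) (hβ : HasDerivAt β b t) :
    HasDerivAt (fun s => f (α s) (β s)) (f₁ (α t) (β t) * a + f₂ (α t) (β t) * b) t := by
  have := (hasStrictFDerivAt_of_continuous_partials h₁ h₂ c₁ c₂
    (α t, β t)).hasFDerivAt.comp_hasDerivAt t (hα.prodMk hβ)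
  refine this.congr_deriv ?_
  simp [mul_comm]

/-- Each branch is needed only on its own half-line. Writing the glued derivative with `min` and
`max` makes its continuity immediate, without cases. -/
theorem hasDerivAt_min_add_max {f g f' g' : ℝ → ℝ} {c x : ℝ}
    (hf : x ≤ 0 → HasDerivAt f (f' x) x) (hg : 0 ≤ x → HasDerivAt g (g' x) x)
    (hf0 : f' 0 = c) (hg0 : g' 0 = c) :
    HasDerivAt (fun x => f (min x 0) + g (max x 0)) (f' (min x 0) + g' (max x 0) - c) x := by
  rcases lt_trichotomy x 0 with hx | rfl | hx
  · rw [min_eq_left hx.le, max_eq_right hx.le, hg0, add_sub_cancel_right]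
    refine ((hf hx.le).add_const (g 0)).congr_of_eventuallyEq ?_
    filter_upwards [Iio_mem_nhds hx] with y (hy : y < 0)
    rw [min_eq_left hy.le, max_eq_right hy.le]
  · rw [min_self, max_self, hg0, add_sub_cancel_right]
    have h1 : HasDerivWithinAt (fun x => f (min x 0) + g (max x 0)) (f' 0) (Iic 0) 0 := by
      refine ((hf le_rfl).add_const (g 0)).hasDerivWithinAt.congr_of_mem (fun y hy => ?_)
        (mem_Iic.2 le_rfl)
      rw [min_eq_left hy, max_eq_right hy]
    have h2 : HasDerivWithinAt (fun x => f (min x 0) + g (max x 0)) (f' 0) (Ici 0) 0 := by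
      rw [hf0, ← hg0]
      refine ((hg le_rfl).const_add (f 0)).hasDerivWithinAt.congr_of_mem (fun y hy => ?_)
        (mem_Ici.2 le_rfl)
      rw [min_eq_right hy, max_eq_left hy]
    have := h1.union h2
    rwa [Iic_union_Ici, hasDerivWithinAt_univ] at this
  · rw [min_eq_right hx.le, max_eq_left hx.le, hf0, add_sub_cancel_left]
    refine ((hg hx.le).const_add (f 0)).congr_of_eventuallyEq ?_
    filter_upwards [Ioi_mem_nhds hx] with y (hy : 0 < y)
    rw [min_eq_right hy.le, max_eq_left hy.le]

end calculus

/-! ### Trajectories entering through the inflow boundary -/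

section inlet

variable {K P : ℝ → ℝ} {L B : ℝ≥0}

theorem hasDerivAt_flow_comp (hK : IsTame K L B) (hP : Continuous P) {α β : ℝ → ℝ} {a b t : ℝ}
    (hα : HasDerivAt α a t) (hβ : HasDerivAt β b t) :
    HasDerivAt (fun s => flow K P 0 (β s) (α s))
      (K (flow K P 0 (β t) (α t) + P (α t)) * a + flowRatio K P (α t) (β t) (β t) * b) t :=
  hasDerivAt_comp_of_continuous_partials (f := fun t x => flow K P 0 x t)
    (f₁ := fun t x => K (flow K P 0 x t + P t)) (f₂ := fun t x => flowRatio K P t x x)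
    (fun t x => hasDerivAt_flow hK hP 0 x t) (fun t x => hasDerivAt_flow_initial hK hP t x)
    (hK.contDiff.continuous.comp ((continuous_flow hK hP).add (hP.comp continuous_fst)))
    ((continuous_flowRatio hK hP).comp (by fun_prop : Continuous fun p : ℝ × ℝ => (p.1, p.2, p.2)))
    hα hβ

/-- The value at time `0` of the trajectory that equals `-P s` at time `s`. -/
def inlet (K P : ℝ → ℝ) (s : ℝ) : ℝ := flow K P s (-P s) 0

theorem flow_inlet (hK : IsTame K L B) (hP : Continuous P) (s : ℝ) :
    flow K P 0 (inlet K P s) s = -P s := by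
  rw [inlet, flow_flow hK hP, flow_self hK hP]

theorem inlet_zero (hK : IsTame K L B) (hP : Continuous P) : inlet K P 0 = -P 0 :=
  flow_self hK hP _ _

/-- This replaces the implicit function theorem: the right-hand side vanishes at `r = s`, and
division by the positive factor gives the increments of `inlet`. Continuity and differentiability of
`inlet` both follow from it. -/
theorem inlet_sub_mul (hK : IsTame K L B) (hP : Continuous P) (r s : ℝ) :
    (inlet K P r - inlet K P s) * flowRatio K P r (inlet K P r) (inlet K P s) =
      -(flow K P 0 (inlet K P s) r + P r) := by
  rw [← flow_sub_flow hK hP, flow_inlet hK hP]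
  ring

theorem continuous_inlet (hK : IsTame K L B) (hP : Continuous P) : Continuous (inlet K P) := by
  rw [continuous_iff_continuousAt]
  intro s
  have h1 : Tendsto (fun r => inlet K P r - inlet K P s) (𝓝 s) (𝓝 0) := by
    refine squeeze_zero_norm
      (a := fun r => |flow K P 0 (inlet K P s) r + P r| * Real.exp (L * |r|)) (fun r => ?_) ?_
    · have h := congrArg abs (inlet_sub_mul hK hP r s)
      rw [abs_mul, abs_of_pos (flowRatio_pos _ _ _ _ _), abs_neg] at h
      rw [← h, mul_assoc, Real.norm_eq_abs]
      refine le_mul_of_one_le_right (abs_nonneg _) ?_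
      calc (1 : ℝ) = Real.exp (-(L * |r|)) * Real.exp (L * |r|) := by rw [← Real.exp_add]; simp
        _ ≤ _ := mul_le_mul_of_nonneg_right (le_flowRatio hK _ _ _) (Real.exp_pos _).le
    · have h1 := continuous_flow_time hK hP 0 (inlet K P s)
      have : Continuous fun r => |flow K P 0 (inlet K P s) r + P r| * Real.exp (L * |r|) := by
        fun_prop
      simpa [flow_inlet hK hP] using this.tendsto s
  simpa [ContinuousAt] using h1.add_const (inlet K P s)

theorem hasDerivAt_inlet (hK : IsTame K L B) (hP : Continuous P) {s p : ℝ}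
    (hp : HasDerivAt P p s) :
    HasDerivAt (inlet K P) (-(K 0 + p) / flowRatio K P s (inlet K P s) (inlet K P s)) s := by
  have hW : HasDerivAt (fun r => flow K P 0 (inlet K P s) r + P r) (K 0 + p) s := by
    refine ((hasDerivAt_flow hK hP 0 (inlet K P s) s).add hp).congr_deriv ?_
    rw [flow_inlet hK hP, neg_add_cancel]
  rw [hasDerivAt_iff_tendsto_slope] at hW ⊢
  have hc : Continuous fun r => flowRatio K P r (inlet K P r) (inlet K P s) := by
    have := continuous_inlet hK hP
    exact (continuous_flowRatio hK hP).comp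
      (by fun_prop : Continuous fun r : ℝ => (r, inlet K P r, inlet K P s))
  refine (hW.neg.div ((hc.tendsto s).mono_left nhdsWithin_le_nhds)
    (flowRatio_pos _ _ _ _ _).ne').congr' ?_
  filter_upwards [self_mem_nhdsWithin] with r hr
  have hr' : r - s ≠ 0 := sub_ne_zero.2 hr
  have hE := (flowRatio_pos K P r (inlet K P r) (inlet K P s)).ne'
  have h := inlet_sub_mul hK hP r s
  simp only [slope_def_field, flow_inlet hK hP, neg_add_cancel, sub_zero, Pi.div_apply]
  rw [div_eq_iff hE]
  field_simp
  linarith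

end inlet

/-! ### The weighted contraction estimate -/

section stability

/-- Two solutions of `z' = K (z + P t)` with close drifts stay close: weighted form over a time
interval of length at most one. -/
theorem abs_sub_le_half_of_trajectories {K P₁ P₂ z₁ z₂ : ℝ → ℝ} {L : ℝ≥0} {A lam σ τ : ℝ}
    (hK : LipschitzWith L K) (hA : 0 < A) (hlam : 5 * L + 5 ≤ lam)
    (hσ : σ = max (τ - 1) 0) (hτ : 0 ≤ τ)
    (hz₁ : ContinuousOn z₁ (Icc σ τ)) (hz₂ : ContinuousOn z₂ (Icc σ τ))
    (hd₁ : ∀ r ∈ Ico σ τ, HasDerivWithinAt z₁ (K (z₁ r + P₁ r)) (Ici r) r)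
    (hd₂ : ∀ r ∈ Ico σ τ, HasDerivWithinAt z₂ (K (z₂ r + P₂ r)) (Ici r) r)
    (hP : ∀ r ∈ Icc σ τ, |P₁ r - P₂ r| ≤ A * Real.exp (lam * r))
    (h0 : τ ≤ 1 → z₁ σ = z₂ σ)
    (h1 : 1 ≤ τ → |z₁ σ - z₂ σ| ≤ A * Real.exp (lam * σ)) :
    |z₁ τ - z₂ τ| ≤ A / 2 * Real.exp (lam * τ) := by
  have hL : (0 : ℝ) ≤ L := L.2
  -- `θ` bounds the initial gap: zero for `τ ≤ 1`. Otherwise the start is one time unit earlier, and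
  -- the weight outgrows the factor `exp (L + 1)` by at least `exp 4`, because `lam - (L + 1) ≥ 4`.
  obtain ⟨θ, hθ, hθσ, hθτ⟩ : ∃ θ : ℝ, 0 ≤ θ ∧ |z₁ σ - z₂ σ| ≤ θ ∧
      θ * Real.exp ((L + 1) * (τ - σ)) ≤ A / 4 * Real.exp (lam * τ) := by
    rcases le_total τ 1 with h | h
    · exact ⟨0, le_rfl, by simp [h0 h], by simp only [zero_mul]; positivity⟩
    · refine ⟨_, by positivity, h1 h, ?_⟩
      have hσ' : σ = τ - 1 := by rw [hσ, max_eq_left (by linarith)]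
      have h4 : Real.exp (-4) ≤ 1 / 4 := by
        have := Real.add_one_le_exp (4 : ℝ)
        rw [Real.exp_neg, ← one_div]
        exact one_div_le_one_div_of_le (by norm_num) (by linarith)
      calc A * Real.exp (lam * σ) * Real.exp ((L + 1) * (τ - σ))
          = A * Real.exp (lam * τ + (L + 1 - lam)) := by
            rw [mul_assoc, ← Real.exp_add]; congr 2; rw [hσ']; ring
        _ ≤ A * Real.exp (lam * τ + (-4)) := by gcongr; linarith
        _ = A * Real.exp (-4) * Real.exp (lam * τ) := by rw [Real.exp_add]; ring
        _ ≤ A / 4 * Real.exp (lam * τ) := by gcongr; nlinarith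
  have hστ : σ ≤ τ := by rw [hσ]; exact max_le (by linarith) hτ
  -- A strict supersolution: the first term needs `5/4 * L < lam / 4`, whence `lam ≥ 5 * L + 5`; the
  -- second uses the rate `L + 1 > L`.
  set b : ℝ → ℝ := fun r => A / 4 * Real.exp (lam * r) + θ * Real.exp ((L + 1) * (r - σ)) with hb
  have hbd : ∀ r, HasDerivAt b (A / 4 * (Real.exp (lam * r) * lam) +
      θ * (Real.exp ((L + 1) * (r - σ)) * (L + 1))) r := by
    intro r
    have e1 : HasDerivAt (fun r : ℝ => lam * r) lam r := by
      simpa using (hasDerivAt_id r).const_mul lam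
    have e2 : HasDerivAt (fun r : ℝ => ((L : ℝ) + 1) * (r - σ)) (L + 1) r := by
      simpa using ((hasDerivAt_id r).sub_const σ).const_mul ((L : ℝ) + 1)
    exact (e1.exp.const_mul _).add (e2.exp.const_mul _)
  have := image_norm_le_of_norm_deriv_right_lt_deriv_boundary (f := fun r => z₁ r - z₂ r)
    (f' := fun r => K (z₁ r + P₁ r) - K (z₂ r + P₂ r)) (hz₁.sub hz₂)
    (fun r hr => (hd₁ r hr).sub (hd₂ r hr)) (B := b) (by
      simp only [hb, sub_self, mul_zero, Real.exp_zero, mul_one, Real.norm_eq_abs]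
      have : 0 ≤ A / 4 * Real.exp (lam * σ) := by positivity
      linarith) hbd (fun r hr heq => ?_) (right_mem_Icc.2 hστ)
  · rw [Real.norm_eq_abs] at this
    refine this.trans ?_
    simp only [hb]
    linarith
  · have hk := hK.dist_le_mul (z₁ r + P₁ r) (z₂ r + P₂ r)
    simp only [Real.dist_eq] at hk
    have h2 : |z₁ r + P₁ r - (z₂ r + P₂ r)| ≤ b r + A * Real.exp (lam * r) := by
      rw [← heq, show z₁ r + P₁ r - (z₂ r + P₂ r) = (z₁ r - z₂ r) + (P₁ r - P₂ r) by ring]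
      exact (abs_add_le _ _).trans (add_le_add le_rfl (hP r (Ico_subset_Icc_self hr)))
    refine (hk.trans (mul_le_mul_of_nonneg_left h2 hL)).trans_lt ?_
    simp only [hb]
    have hE : 0 < A * Real.exp (lam * r) := by positivity
    have hF : 0 ≤ θ * Real.exp ((L + 1) * (r - σ)) := by positivity
    nlinarith [mul_le_mul_of_nonneg_left hlam hE.le]

end stability

/-! ### The fixed-point equation for the cumulative rate -/

/-- The value extrapolated to time `0` of `Q - P` along the characteristic `τ - η = s`: it starts
from the initial datum `q` when `s ≤ 0`, from the inflow boundary when `0 ≤ s`. -/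
def label (K P q : ℝ → ℝ) (s : ℝ) : ℝ := q (-(min s 0)) + inlet K P (max s 0)

/-- The map whose fixed points are the cumulative firing rates; `c` is the slope imposed at
negative times. -/
def rateMap (K q : ℝ → ℝ) (c : ℝ) (P : ℝ → ℝ) (τ : ℝ) : ℝ :=
  c * min τ 0 + (q 1 - flow K P 0 (label K P q (max τ 0 - 1)) (max τ 0))

/-- Continuous functions that are linear with slope `c` at non-positive times. -/
def IsAdmissible (c : ℝ) (P : ℝ → ℝ) : Prop := Continuous P ∧ ∀ τ ≤ 0, P τ = c * τ

section

variable {K P q : ℝ → ℝ} {L B : ℝ≥0} {c : ℝ}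

theorem IsAdmissible.continuous (hP : IsAdmissible c P) : Continuous P := hP.1

theorem IsAdmissible.zero (hP : IsAdmissible c P) : P 0 = 0 := by simpa using hP.2 0 le_rfl

theorem label_of_nonpos (hK : IsTame K L B) (hP : IsAdmissible c P) {s : ℝ} (hs : s ≤ 0) :
    label K P q s = q (-s) := by
  rw [label, min_eq_left hs, max_eq_right hs, inlet_zero hK hP.continuous, hP.zero]
  simp

theorem label_of_nonneg (hq0 : q 0 = 0) {s : ℝ} (hs : 0 ≤ s) :
    label K P q s = inlet K P s := by
  rw [label, min_eq_right hs, max_eq_left hs, neg_zero, hq0, zero_add]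

theorem continuous_label (hK : IsTame K L B) (hP : Continuous P) (hq : Continuous q) :
    Continuous (label K P q) :=
  (hq.comp (by fun_prop : Continuous fun s : ℝ => -(min s 0))).add
    ((continuous_inlet hK hP).comp (by fun_prop : Continuous fun s : ℝ => max s 0))

theorem rateMap_of_nonpos (hK : IsTame K L B) (hP : IsAdmissible c P) {τ : ℝ} (hτ : τ ≤ 0) :
    rateMap K q c P τ = c * τ := by
  rw [rateMap, min_eq_left hτ, max_eq_right hτ, flow_self hK hP.continuous,
    label_of_nonpos hK hP (by norm_num)]
  simp

theorem rateMap_of_nonneg {τ : ℝ} (hτ : 0 ≤ τ) :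
    rateMap K q c P τ = q 1 - flow K P 0 (label K P q (τ - 1)) τ := by
  rw [rateMap, min_eq_right hτ, max_eq_left hτ]
  ring

theorem IsAdmissible.rateMap (hK : IsTame K L B) (hq : Continuous q) (hP : IsAdmissible c P) :
    IsAdmissible c (rateMap K q c P) := by
  refine ⟨?_, fun τ hτ => rateMap_of_nonpos hK hP hτ⟩
  have h1 : Continuous fun τ : ℝ => label K P q (max τ 0 - 1) :=
    (continuous_label hK hP.continuous hq).comp (by fun_prop)
  have h2 : Continuous fun τ : ℝ => flow K P 0 (label K P q (max τ 0 - 1)) (max τ 0) :=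
    (continuous_flow hK hP.continuous).comp
      ((by fun_prop : Continuous fun τ : ℝ => max τ 0).prodMk h1)
  unfold PulseCoupled.rateMap
  fun_prop

/-- The trajectory ending at `τ` starts from the common datum, or from `-P` at time `τ - 1`, where
the gap is already controlled by the hypothesis. -/
theorem abs_rateMap_sub_le {P₁ P₂ : ℝ → ℝ} {A lam : ℝ} (hK : IsTame K L B) (hq0 : q 0 = 0)
    (hP₁ : IsAdmissible c P₁) (hP₂ : IsAdmissible c P₂) (hA : 0 < A) (hlam : 5 * L + 5 ≤ lam)
    (h : ∀ r, 0 ≤ r → |P₁ r - P₂ r| ≤ A * Real.exp (lam * r)) {τ : ℝ} (hτ : 0 ≤ τ) :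
    |rateMap K q c P₁ τ - rateMap K q c P₂ τ| ≤ A / 2 * Real.exp (lam * τ) := by
  rw [rateMap_of_nonneg hτ, rateMap_of_nonneg hτ, sub_sub_sub_cancel_left, abs_sub_comm]
  have hσ : 0 ≤ max (τ - 1) 0 := le_max_right _ _
  refine abs_sub_le_half_of_trajectories (P₁ := P₁) (P₂ := P₂) hK.lipschitz hA hlam rfl hτ
    (continuous_flow_time hK hP₁.1 _ _).continuousOn (continuous_flow_time hK hP₂.1 _ _).continuousOn
    (fun r _ => (hasDerivAt_flow hK hP₁.1 _ _ r).hasDerivWithinAt)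
    (fun r _ => (hasDerivAt_flow hK hP₂.1 _ _ r).hasDerivWithinAt)
    (fun r hr => h r (hσ.trans hr.1)) (fun h1 => ?_) (fun h1 => ?_)
  · rw [max_eq_right (by linarith), flow_self hK hP₁.1, flow_self hK hP₂.1,
      label_of_nonpos hK hP₁ (by linarith), label_of_nonpos hK hP₂ (by linarith)]
  · have h2 : 0 ≤ τ - 1 := by linarith
    rw [max_eq_left h2, label_of_nonneg hq0 h2, label_of_nonneg hq0 h2, flow_inlet hK hP₁.1,
      flow_inlet hK hP₂.1, neg_sub_neg, abs_sub_comm]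
    exact h _ h2

/-- This starts the iteration. A trajectory is followed for at most one time unit, at speed at most
`B`, from a bounded value, so the bound is uniform in `τ`. -/
theorem exists_abs_rateMap_le (hK : IsTame K L B) (hq : Continuous q) (hq0 : q 0 = 0) :
    ∃ A : ℝ, 0 < A ∧ ∀ τ, 0 ≤ τ → |rateMap K q c (fun τ => c * min τ 0) τ| ≤ A := by
  set P : ℝ → ℝ := fun τ => c * min τ 0 with hPdef
  have hP : IsAdmissible c P := ⟨by fun_prop, fun τ hτ => by simp [hPdef, hτ]⟩
  have hP0 : ∀ s, 0 ≤ s → P s = 0 := fun s hs => by simp [hPdef, hs]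
  obtain ⟨C, hC⟩ := (isCompact_Icc (a := (0 : ℝ)) (b := 1)).exists_bound_of_continuousOn
    hq.continuousOn
  have hC0 : 0 ≤ C := (norm_nonneg _).trans (hC 0 (by simp))
  refine ⟨C + (C + B + 1), by positivity, fun τ hτ => ?_⟩
  rw [rateMap_of_nonneg hτ]
  refine (abs_sub _ _).trans (add_le_add (hC 1 (by simp)) ?_)
  set z := flow K P 0 (label K P q (τ - 1)) with hz
  set σ := max (τ - 1) 0 with hσ
  have hσ0 : 0 ≤ σ := le_max_right _ _
  have hστ : |τ - σ| ≤ 1 := by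
    rw [abs_le]
    constructor
    · linarith [max_le (by linarith : τ - 1 ≤ τ) hτ]
    · linarith [le_max_left (τ - 1) 0]
  have h1 : |z σ| ≤ C := by
    rcases le_total τ 1 with h | h
    · rw [hσ, max_eq_right (by linarith), hz, flow_self hK hP.1,
        label_of_nonpos hK hP (by linarith)]
      exact hC _ ⟨by linarith, by linarith⟩
    · have h2 : 0 ≤ τ - 1 := by linarith
      rw [hσ, max_eq_left h2, hz, label_of_nonneg hq0 h2, flow_inlet hK hP.1, hP0 _ h2]
      simpa using hC0
  have h2 : |z τ - z σ| ≤ B * |τ - σ| := by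
    have := Convex.norm_image_sub_le_of_norm_hasDerivWithin_le (f := z) (s := univ) (C := B)
      (fun r _ => (hasDerivAt_flow hK hP.1 _ _ r).hasDerivWithinAt) (fun r _ => hK.bounded _)
      convex_univ (mem_univ σ) (mem_univ τ)
    simpa using this
  have h3 : (B : ℝ) * |τ - σ| ≤ B := mul_le_of_le_one_right B.2 hστ
  have h4 : |z τ| ≤ |z τ - z σ| + |z σ| := by simpa using abs_add_le (z τ - z σ) (z σ)
  linarith

/-- Successive Picard iterates get closer by a factor `1/2` in the weighted norm. The weight is
bounded on bounded sets, so convergence is locally uniform and the limit is continuous. -/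
theorem exists_fixedPoint_rateMap (hK : IsTame K L B) (hq : Continuous q) (hq0 : q 0 = 0) (c : ℝ) :
    ∃ P, IsAdmissible c P ∧ rateMap K q c P = P := by
  obtain ⟨A, hA, hA'⟩ := exists_abs_rateMap_le (c := c) hK hq hq0
  set lam : ℝ := 5 * L + 5 with hlam
  have hlam0 : 0 ≤ lam := by positivity
  set u : ℕ → ℝ → ℝ := fun n => (rateMap K q c)^[n] (fun τ => c * min τ 0) with hu
  have hsucc : ∀ n, u (n + 1) = rateMap K q c (u n) := fun n =>
    Function.iterate_succ_apply' _ _ _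
  have hadm : ∀ n, IsAdmissible c (u n) := by
    intro n
    induction n with
    | zero => exact ⟨by simp only [hu, Function.iterate_zero, id]; fun_prop,
        fun τ hτ => by simp [hu, hτ]⟩
    | succ n ih => rw [hsucc]; exact ih.rateMap hK hq
  have hstep : ∀ n, ∀ τ, 0 ≤ τ → |u n τ - u (n + 1) τ| ≤ A / 2 ^ n * Real.exp (lam * τ) := by
    intro n
    induction n with
    | zero =>
      intro τ hτ
      have h0 : u 0 τ = 0 := by simp [hu, hτ]
      rw [h0, zero_sub, abs_neg, hsucc, pow_zero, div_one]
      exact (hA' τ hτ).trans (le_mul_of_one_le_right hA.le (Real.one_le_exp (by positivity)))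
    | succ n ih =>
      intro τ hτ
      have := abs_rateMap_sub_le hK hq0 (hadm n) (hadm (n + 1)) (by positivity) hlam.ge ih hτ
      rw [hsucc n, hsucc (n + 1), pow_succ, ← div_div]
      exact this
  have hdist : ∀ τ n, dist (u n τ) (u (n + 1) τ) ≤ 2 * A * Real.exp (lam * |τ|) / 2 / 2 ^ n := by
    intro τ n
    rcases le_total 0 τ with hτ | hτ
    · rw [Real.dist_eq, abs_of_nonneg hτ]
      refine (hstep n τ hτ).trans_eq ?_
      ring
    · rw [(hadm n).2 τ hτ, (hadm (n + 1)).2 τ hτ, dist_self]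
      positivity
  choose P hPlim using fun τ =>
    cauchySeq_tendsto_of_complete (cauchySeq_of_le_geometric_two (hdist τ))
  have hclose : ∀ τ n, dist (u n τ) (P τ) ≤ 2 * A * Real.exp (lam * |τ|) / 2 ^ n := fun τ n =>
    dist_le_of_le_geometric_two_of_tendsto (hdist τ) (hPlim τ) n
  have hgeo : ∀ C : ℝ, Tendsto (fun n : ℕ => C / 2 ^ n) atTop (𝓝 0) := fun C => by
    have := (tendsto_pow_atTop_nhds_zero_of_lt_one (r := (1 / 2 : ℝ)) (by norm_num)
      (by norm_num)).const_mul C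
    rw [mul_zero] at this
    exact this.congr fun n => by rw [one_div, inv_pow, div_eq_mul_inv]
  have hPc : Continuous P := by
    refine TendstoLocallyUniformly.continuous (F := u) (p := atTop) ?_
      (Eventually.of_forall fun n => (hadm n).1).frequently
    rw [Metric.tendstoLocallyUniformly_iff]
    intro ε hε x
    have hnb : {τ : ℝ | |τ| < |x| + 1} ∈ 𝓝 x :=
      continuous_abs.continuousAt.eventually_lt continuousAt_const (lt_add_one _)
    refine ⟨_, hnb, ?_⟩
    filter_upwards [(hgeo (2 * A * Real.exp (lam * (|x| + 1)))).eventually (gt_mem_nhds hε)]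
      with n hn τ hτ
    have hτ' : |τ| < |x| + 1 := hτ
    rw [dist_comm]
    refine (hclose τ n).trans_lt (lt_of_le_of_lt ?_ hn)
    gcongr
  have hPadm : IsAdmissible c P := ⟨hPc, fun τ hτ =>
    tendsto_nhds_unique (hPlim τ) (tendsto_const_nhds.congr fun n => ((hadm n).2 τ hτ).symm)⟩
  refine ⟨P, hPadm, funext fun τ => ?_⟩
  rcases le_total τ 0 with hτ | hτ
  · rw [rateMap_of_nonpos hK hPadm hτ, hPadm.2 τ hτ]
  · refine tendsto_nhds_unique ?_ ((tendsto_add_atTop_iff_nat 1).2 (hPlim τ))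
    rw [tendsto_iff_dist_tendsto_zero]
    refine squeeze_zero (fun _ => dist_nonneg) (fun n => ?_) (hgeo (A * Real.exp (lam * τ)))
    have := abs_rateMap_sub_le (A := 2 * A / 2 ^ n) hK hq0 (hadm n) hPadm (by positivity) hlam.ge
      (fun r hr => by
        have := hclose r n
        rw [Real.dist_eq, abs_of_nonneg hr] at this
        exact this.trans_eq (by ring)) hτ
    rw [hsucc, Real.dist_eq]
    exact this.trans_eq (by ring)

end

/-! ### One-variable calculus on open and half-open sets -/

section calculus

theorem contDiffOn_one_of_hasDerivAt {f f' : ℝ → ℝ} {U : Set ℝ} (hU : IsOpen U)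
    (hf : ∀ x ∈ U, HasDerivAt f (f' x) x) (hf' : ContinuousOn f' U) : ContDiffOn ℝ 1 f U := by
  rw [show (1 : WithTop ℕ∞) = 0 + 1 from rfl, contDiffOn_succ_iff_deriv_of_isOpen hU]
  refine ⟨fun x hx => (hf x hx).differentiableAt.differentiableWithinAt, by simp, ?_⟩
  rw [contDiffOn_zero]
  exact hf'.congr fun x hx => (hf x hx).deriv

theorem hasDerivAt_of_contDiffOn_one {f : ℝ → ℝ} {U : Set ℝ} (hU : IsOpen U)
    (hf : ContDiffOn ℝ 1 f U) {x : ℝ} (hx : x ∈ U) : HasDerivAt f (deriv f x) x :=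
  ((hf.differentiableOn one_ne_zero x hx).differentiableAt (hU.mem_nhds hx)).hasDerivAt

theorem deriv_eq_of_eqOn_Iic {f g : ℝ → ℝ} {x : ℝ} (hf : DifferentiableAt ℝ f x)
    (hg : DifferentiableAt ℝ g x) (h : EqOn f g (Iic x)) : deriv f x = deriv g x := by
  have h1 := hf.hasDerivAt.hasDerivWithinAt (s := Iic x)
  have h2 := (hg.hasDerivAt.hasDerivWithinAt (s := Iic x)).congr h (h (mem_Iic.2 le_rfl))
  exact (uniqueDiffWithinAt_Iic x).eq_deriv _ h1 h2

theorem deriv_eq_of_eqOn_Ici {f g : ℝ → ℝ} {x : ℝ} (hf : DifferentiableAt ℝ f x)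
    (hg : DifferentiableAt ℝ g x) (h : EqOn f g (Ici x)) : deriv f x = deriv g x := by
  have h1 := hf.hasDerivAt.hasDerivWithinAt (s := Ici x)
  have h2 := (hg.hasDerivAt.hasDerivWithinAt (s := Ici x)).congr h (h (mem_Ici.2 le_rfl))
  exact (uniqueDiffWithinAt_Ici x).eq_deriv _ h1 h2

end calculus

/-! ### Regularity of the fixed point by the method of steps -/

section regularity

variable {K P q : ℝ → ℝ} {L B : ℝ≥0} {c : ℝ}

theorem continuous_flowRatio_diag (hK : IsTame K L B) (hP : Continuous P) {α β : ℝ → ℝ}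
    {s : Set ℝ} (hα : ContinuousOn α s) (hβ : ContinuousOn β s) :
    ContinuousOn (fun t => flowRatio K P (α t) (β t) (β t)) s :=
  Continuous.comp_continuousOn (g := fun p : ℝ × ℝ × ℝ => flowRatio K P p.1 p.2.1 p.2.2)
    (f := fun t => (α t, β t, β t)) (continuous_flowRatio hK hP) (hα.prodMk (hβ.prodMk hβ))

theorem IsAdmissible.deriv_zero (hP : IsAdmissible c P) (hd : DifferentiableAt ℝ P 0) :
    deriv P 0 = c := by
  rw [deriv_eq_of_eqOn_Iic hd (g := fun τ => c * τ) (by fun_prop) fun τ hτ => hP.2 τ hτ]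
  simp

theorem contDiffOn_label (hK : IsTame K L B) (hq : ContDiff ℝ 1 q) (hP : IsAdmissible c P)
    (hc : c = deriv q 0 - K 0) {a : ℝ} (ha : 0 ≤ a)
    (hPa : ContDiffOn ℝ 1 P (Iio a)) : ContDiffOn ℝ 1 (label K P q) (Iio a) := by
  -- For `a = 0` the junction point `0` is not in `Iio a`, and only the branch of the datum matters.
  rcases ha.eq_or_lt with rfl | ha
  · exact (hq.comp contDiff_neg).contDiffOn.congr fun s hs => label_of_nonpos hK hP (le_of_lt hs)
  have hq' := hq.continuous_deriv le_rfl
  have hP0 : deriv P 0 = c :=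
    hP.deriv_zero (hasDerivAt_of_contDiffOn_one isOpen_Iio hPa ha).differentiableAt
  have hmax : ∀ s ∈ Iio a, max s 0 ∈ Iio a := fun s hs => max_lt hs ha
  refine contDiffOn_one_of_hasDerivAt isOpen_Iio (f' := fun s => -deriv q (-(min s 0)) +
    -(K 0 + deriv P (max s 0)) /
      flowRatio K P (max s 0) (inlet K P (max s 0)) (inlet K P (max s 0)) - -deriv q 0)
    (fun s hs => ?_) ?_
  · refine hasDerivAt_min_add_max (f := fun s => q (-s)) (f' := fun s => -deriv q (-s))
      (g := inlet K P) (g' := fun s => -(K 0 + deriv P s) / flowRatio K P s (inlet K P s)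
        (inlet K P s)) (fun _ => ?_) (fun _ => hasDerivAt_inlet hK hP.1
        (hasDerivAt_of_contDiffOn_one isOpen_Iio hPa hs)) (by simp) ?_
    · have := ((hq.differentiable one_ne_zero (-s)).hasDerivAt).scomp s (hasDerivAt_neg s)
      exact this.congr_deriv (by simp)
    · rw [hP0, flowRatio_zero, hc]
      ring
  · have hd : ContinuousOn (fun s => deriv P (max s 0)) (Iio a) :=
      (hPa.continuousOn_deriv_of_isOpen isOpen_Iio le_rfl).comp (by fun_prop) hmax
    have hi := continuous_inlet hK hP.1
    have hm : Continuous fun s : ℝ => max s 0 := by fun_prop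
    refine ContinuousOn.sub (ContinuousOn.add ?_ (ContinuousOn.div ?_
      (continuous_flowRatio_diag hK hP.1 hm.continuousOn (hi.comp hm).continuousOn)
      fun s _ => (flowRatio_pos _ _ _ _ _).ne')) continuousOn_const
    · exact (by fun_prop : Continuous fun s : ℝ => -deriv q (-(min s 0))).continuousOn
    · fun_prop

theorem deriv_label_of_nonpos (hK : IsTame K L B) (hq : ContDiff ℝ 1 q) (hP : IsAdmissible c P)
    {s : ℝ} (hs : s ≤ 0) (hd : DifferentiableAt ℝ (label K P q) s) :
    deriv (label K P q) s = -deriv q (-s) := by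
  have hq1 : DifferentiableAt ℝ (fun s => q (-s)) s :=
    (hq.comp contDiff_neg).differentiable one_ne_zero s
  rw [deriv_eq_of_eqOn_Iic hd hq1 fun r hr => label_of_nonpos hK hP (le_trans hr hs),
    deriv_comp_neg]

theorem hasDerivAt_fixedPoint_aux (hK : IsTame K L B) (hP : Continuous P) {τ : ℝ}
    (hl : DifferentiableAt ℝ (label K P q) (τ - 1)) :
    HasDerivAt (fun τ => q 1 - flow K P 0 (label K P q (τ - 1)) τ)
      (-(K (flow K P 0 (label K P q (τ - 1)) τ + P τ) +
        flowRatio K P τ (label K P q (τ - 1)) (label K P q (τ - 1)) *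
          deriv (label K P q) (τ - 1))) τ := by
  have hl' : HasDerivAt (fun τ => label K P q (τ - 1)) (deriv (label K P q) (τ - 1)) τ := by
    simpa using hl.hasDerivAt.comp_sub_const τ 1
  simpa using (hasDerivAt_flow_comp hK hP (hasDerivAt_id τ) hl').const_sub (q 1)

theorem contDiffOn_fixedPoint_succ (hK : IsTame K L B) (hq : ContDiff ℝ 1 q)
    (hP : IsAdmissible c P) (hfix : rateMap K q c P = P)
    (hc : c = deriv q 1 - K (q 1)) {a : ℝ} (ha : 0 ≤ a)
    (hl : ContDiffOn ℝ 1 (label K P q) (Iio a)) : ContDiffOn ℝ 1 P (Iio (a + 1)) := by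
  have hlc := continuous_label hK hP.1 hq.continuous
  have hmax : ∀ s ∈ Iio (a + 1), max s 0 - 1 ∈ Iio a := fun s hs => by
    have : max s 0 < a + 1 := max_lt hs (by linarith)
    simp only [mem_Iio]; linarith
  have hm1 : (0 : ℝ) - 1 ∈ Iio a := by simp only [mem_Iio]; linarith
  set R' : ℝ → ℝ := fun τ => -(K (flow K P 0 (label K P q (τ - 1)) τ + P τ) +
        flowRatio K P τ (label K P q (τ - 1)) (label K P q (τ - 1)) *
          deriv (label K P q) (τ - 1)) with hR'
  have hd : ∀ s ∈ Iio a, DifferentiableAt ℝ (label K P q) s := fun s hs =>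
    (hasDerivAt_of_contDiffOn_one isOpen_Iio hl hs).differentiableAt
  have hm1' := label_of_nonpos (q := q) hK hP (by norm_num : (0 : ℝ) - 1 ≤ 0)
  have hd1 := deriv_label_of_nonpos hK hq hP (by norm_num : (0 : ℝ) - 1 ≤ 0) (hd _ hm1)
  norm_num at hm1' hd1
  refine contDiffOn_one_of_hasDerivAt isOpen_Iio (f' := fun τ => c + R' (max τ 0) - c)
    (fun τ hτ => ?_) ?_
  · have hR := hasDerivAt_min_add_max (x := τ) (c := c) (f := fun τ => c * τ) (f' := fun _ => c)
      (g := fun τ => q 1 - flow K P 0 (label K P q (τ - 1)) τ) (g' := R')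
      (fun _ => by simpa using (hasDerivAt_id τ).const_mul c)
      (fun h0 => hasDerivAt_fixedPoint_aux hK hP.1 (hd _ (by
        simpa [max_eq_left h0] using hmax τ hτ))) rfl (by
        simp only [hR', flow_self hK hP.1, hP.zero, flowRatio_zero, zero_sub, hm1', hd1, hc]
        ring_nf)
    have he : (fun τ => c * min τ 0 + (q 1 - flow K P 0 (label K P q (max τ 0 - 1)) (max τ 0)))
        = P := hfix
    rwa [he] at hR
  · have hm : Continuous fun s : ℝ => max s 0 := by fun_prop
    have hl1 : Continuous fun s : ℝ => label K P q (max s 0 - 1) := hlc.comp (by fun_prop)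
    have hld : ContinuousOn (fun s => deriv (label K P q) (max s 0 - 1)) (Iio (a + 1)) :=
      (hl.continuousOn_deriv_of_isOpen isOpen_Iio le_rfl).comp (by fun_prop) hmax
    have hF : Continuous fun s : ℝ => K (flow K P 0 (label K P q (max s 0 - 1)) (max s 0)
        + P (max s 0)) :=
      hK.contDiff.continuous.comp (((continuous_flow hK hP.1).comp (hm.prodMk hl1)).add
        (hP.1.comp hm))
    exact (continuousOn_const.add ((hF.continuousOn.add ((continuous_flowRatio_diag hK hP.1
      hm.continuousOn hl1.continuousOn).mul hld)).neg)).sub continuousOn_const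

/-- On `Iio a` the label inherits the smoothness of `P`. In the fixed-point equation `P τ` sees the
label at `τ - 1`, and the flow itself requires `P` only to be continuous, so each round gains one
time unit. The two expressions of `c` encode compatibility: `hc0` joins the branches of the label at
`0`, `hc1` those of `P`. -/
theorem contDiff_fixedPoint (hK : IsTame K L B) (hq : ContDiff ℝ 1 q) (hP : IsAdmissible c P)
    (hfix : rateMap K q c P = P) (hc0 : c = deriv q 0 - K 0)
    (hc1 : c = deriv q 1 - K (q 1)) :
    ContDiff ℝ 1 P ∧ ContDiff ℝ 1 (label K P q) := by
  have hPn : ∀ n : ℕ, ContDiffOn ℝ 1 P (Iio n) := by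
    intro n
    induction n with
    | zero =>
      refine ContDiffOn.congr (f := fun τ => c * τ) (by fun_prop) fun τ hτ => hP.2 τ ?_
      exact le_of_lt (by simpa using hτ)
    | succ n ih =>
      push_cast
      exact contDiffOn_fixedPoint_succ hK hq hP hfix hc1 n.cast_nonneg
        (contDiffOn_label hK hq hP hc0 n.cast_nonneg ih)
  have key : ∀ f : ℝ → ℝ, (∀ n : ℕ, ContDiffOn ℝ 1 f (Iio n)) → ContDiff ℝ 1 f := by
    intro f hf
    rw [contDiff_iff_contDiffAt]
    intro x
    obtain ⟨n, hn⟩ := exists_nat_gt x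
    exact (hf n).contDiffAt (Iio_mem_nhds hn)
  exact ⟨key P hPn, key _ fun n => contDiffOn_label hK hq hP hc0 n.cast_nonneg (hPn n)⟩

end regularity

/-- Maximum principle: if `h τ` is the final value of a quantity `g` that relaxes towards `h`,
starting from a value at most `M` or from an earlier value of `h`, then `h ≤ M`. -/
theorem le_of_relaxation {h : ℝ → ℝ} {M : ℝ} (hc : Continuous h) (h0 : h 0 ≤ M)
    (H : ∀ τ, 0 < τ → ∃ σ ∈ Ico 0 τ, ∃ g k : ℝ → ℝ, Continuous k ∧ (∀ r, k r ≤ 0) ∧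
      (∀ r, HasDerivAt g (k r * (g r - h r)) r) ∧ g τ = h τ ∧ (g σ ≤ M ∨ g σ = h σ))
    {τ : ℝ} (hτ : 0 ≤ τ) : h τ ≤ M := by
  -- With a strictly larger level `M'`, there is a first time `t` at which `h` reaches `M'`, and `h
  -- < M'` before it.
  refine le_of_forall_gt fun M' hM' => ?_
  by_contra hcon
  rw [not_lt] at hcon
  have hcomp : IsCompact (Icc 0 τ ∩ {t | M' ≤ h t}) :=
    isCompact_Icc.inter_right (isClosed_le continuous_const hc)
  obtain ⟨t, ⟨⟨ht0, htτ⟩, htM⟩, hleast⟩ :=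
    hcomp.exists_isLeast ⟨τ, right_mem_Icc.2 hτ, hcon⟩
  have htM' : M' ≤ h t := htM
  have hlt : ∀ r, 0 ≤ r → r < t → h r < M' := fun r hr0 hrt => by
    by_contra hr
    exact absurd (hleast ⟨⟨hr0, hrt.le.trans htτ⟩, not_lt.1 hr⟩) (not_le.2 hrt)
  have htpos : 0 < t := by
    rcases ht0.eq_or_lt with rfl | h1
    · linarith
    · exact h1
  obtain ⟨σ, ⟨hσ0, hσt⟩, g, k, hk, hk0, hg, hgt, hgσ⟩ := H t htpos
  have hgσ' : g σ < M' := by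
    rcases hgσ with h1 | h1
    · linarith
    · rw [h1]; exact hlt σ hσ0 hσt
  have hI : ∀ r, HasDerivAt (fun r => ∫ x in σ..r, k x) (k r) r := fun r =>
    intervalIntegral.integral_hasDerivAt_right (hk.intervalIntegrable _ _)
      hk.aestronglyMeasurable.stronglyMeasurableAtFilter hk.continuousAt
  have hw : ∀ r, HasDerivAt (fun r => (g r - M') * Real.exp (-∫ x in σ..r, k x))
      (k r * (M' - h r) * Real.exp (-∫ x in σ..r, k x)) r := fun r =>
    (((hg r).sub_const M').mul (hI r).neg.exp).congr_deriv (by simp only [Pi.neg_apply]; ring)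
  -- The integrating factor leaves a derivative with the sign of `k * (M' - h)`. So `g - M'`,
  -- negative at `σ`, cannot be nonnegative at `t`, contradicting `g t = h t ≥ M'`.
  have hanti : AntitoneOn (fun r => (g r - M') * Real.exp (-∫ x in σ..r, k x)) (Icc σ t) := by
    refine antitoneOn_of_deriv_nonpos (convex_Icc _ _)
      (fun r _ => (hw r).continuousAt.continuousWithinAt)
      (fun r _ => (hw r).differentiableAt.differentiableWithinAt) fun r hr => ?_
    rw [interior_Icc] at hr
    rw [(hw r).deriv]
    exact mul_nonpos_of_nonpos_of_nonneg (mul_nonpos_of_nonpos_of_nonneg (hk0 r)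
      (by linarith [hlt r (hσ0.trans hr.1.le) hr.2])) (Real.exp_pos _).le
  have := hanti (left_mem_Icc.2 hσt.le) (right_mem_Icc.2 hσt.le) hσt.le
  simp only [intervalIntegral.integral_same, neg_zero, Real.exp_zero, mul_one, hgt] at this
  have h2 : 0 ≤ (h t - M') * Real.exp (-∫ x in σ..t, k x) :=
    mul_nonneg (by linarith) (Real.exp_pos _).le
  linarith

/-! ### The solution built from the fixed point, and its bounds -/

section fixedPoint

variable {K P q : ℝ → ℝ} {L B : ℝ≥0} {c : ℝ}

/-- The solution of the transport equation along the characteristics. -/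
def charSolution (K P q : ℝ → ℝ) (τ η : ℝ) : ℝ :=
  flow K P 0 (label K P q (τ - η)) τ + P τ

/-- The `η`-derivative of `charSolution`, in terms of the label `s = τ - η`. -/
def charSlope (K P q : ℝ → ℝ) (s τ : ℝ) : ℝ :=
  -(flowRatio K P τ (label K P q s) (label K P q s) * deriv (label K P q) s)

theorem hasDerivAt_flowRatio (hK : IsTame K L B) (hP : Continuous P) (x t : ℝ) :
    HasDerivAt (fun t => flowRatio K P t x x)
      (deriv K (flow K P 0 x t + P t) * flowRatio K P t x x) t := by
  have hc : Continuous fun r => divDiff K (flow K P 0 x r + P r) (flow K P 0 x r + P r) := by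
    simp_rw [divDiff_self]
    exact (hK.contDiff.continuous_deriv le_rfl).comp ((continuous_flow_time hK hP 0 x).add hP)
  have hI : HasDerivAt (fun t => ∫ r in (0 : ℝ)..t,
      divDiff K (flow K P 0 x r + P r) (flow K P 0 x r + P r))
      (divDiff K (flow K P 0 x t + P t) (flow K P 0 x t + P t)) t :=
    intervalIntegral.integral_hasDerivAt_right (hc.intervalIntegrable _ _)
      hc.aestronglyMeasurable.stronglyMeasurableAtFilter hc.continuousAt
  refine hI.exp.congr_deriv ?_
  rw [divDiff_self, mul_comm, flowRatio]

theorem hasDerivAt_charSolution_time (hK : IsTame K L B) (hP : ContDiff ℝ 1 P)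
    (hl : ContDiff ℝ 1 (label K P q)) (τ η : ℝ) :
    HasDerivAt (fun τ => charSolution K P q τ η)
      (deriv P τ + K (charSolution K P q τ η) - charSlope K P q (τ - η) τ) τ := by
  have hl' : HasDerivAt (fun τ => label K P q (τ - η)) (deriv (label K P q) (τ - η)) τ := by
    simpa using ((hl.differentiable one_ne_zero (τ - η)).hasDerivAt).comp_sub_const τ η
  refine ((hasDerivAt_flow_comp hK hP.continuous (hasDerivAt_id τ) hl').add
    (hP.differentiable one_ne_zero τ).hasDerivAt).congr_deriv ?_
  simp only [charSolution, charSlope, id]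
  ring

theorem hasDerivAt_charSolution_space (hK : IsTame K L B) (hP : ContDiff ℝ 1 P)
    (hl : ContDiff ℝ 1 (label K P q)) (τ η : ℝ) :
    HasDerivAt (fun η => charSolution K P q τ η) (charSlope K P q (τ - η) τ) η := by
  have hl' : HasDerivAt (fun η => label K P q (τ - η)) (-deriv (label K P q) (τ - η)) η := by
    simpa using ((hl.differentiable one_ne_zero (τ - η)).hasDerivAt).comp_const_sub τ η
  refine ((hasDerivAt_flow_comp hK hP.continuous (hasDerivAt_const η τ) hl').add_const
    (P τ)).congr_deriv ?_
  simp only [charSlope]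
  ring

theorem continuous_charSolution (hK : IsTame K L B) (hP : Continuous P)
    (hl : Continuous (label K P q)) :
    Continuous fun p : ℝ × ℝ => charSolution K P q p.1 p.2 :=
  ((continuous_flow hK hP).comp (continuous_fst.prodMk
    (hl.comp (continuous_fst.sub continuous_snd)))).add (hP.comp continuous_fst)

theorem continuous_charSlope (hK : IsTame K L B) (hP : Continuous P)
    (hl : ContDiff ℝ 1 (label K P q)) :
    Continuous fun p : ℝ × ℝ => charSlope K P q (p.1 - p.2) p.1 := by
  have h1 : Continuous fun p : ℝ × ℝ => label K P q (p.1 - p.2) :=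
    hl.continuous.comp (continuous_fst.sub continuous_snd)
  have h2 : Continuous fun p : ℝ × ℝ => deriv (label K P q) (p.1 - p.2) :=
    (hl.continuous_deriv le_rfl).comp (continuous_fst.sub continuous_snd)
  exact (((continuous_flowRatio hK hP).comp (continuous_fst.prodMk (h1.prodMk h1))).mul h2).neg

theorem contDiff_charSolution (hK : IsTame K L B) (hP : ContDiff ℝ 1 P)
    (hl : ContDiff ℝ 1 (label K P q)) :
    ContDiff ℝ 1 fun p : ℝ × ℝ => charSolution K P q p.1 p.2 := by
  have hS := continuous_charSlope hK hP.continuous hl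
  refine contDiff_of_continuous_partials (hasDerivAt_charSolution_time hK hP hl)
    (hasDerivAt_charSolution_space hK hP hl) ?_ hS
  exact (((hP.continuous_deriv le_rfl).comp continuous_fst).add
    (hK.contDiff.continuous.comp (continuous_charSolution hK hP.continuous hl.continuous))).sub hS

theorem charSolution_inflow (hK : IsTame K L B) (hP : Continuous P) (hq0 : q 0 = 0) {τ : ℝ}
    (hτ : 0 ≤ τ) : charSolution K P q τ 0 = 0 := by
  rw [charSolution, sub_zero, label_of_nonneg hq0 hτ, flow_inlet hK hP, neg_add_cancel]

theorem charSolution_outflow (hfix : rateMap K q c P = P) {τ : ℝ} (hτ : 0 ≤ τ) :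
    charSolution K P q τ 1 = q 1 := by
  have := congrFun hfix τ
  rw [rateMap_of_nonneg hτ] at this
  rw [charSolution]
  linarith

theorem charSolution_initial (hK : IsTame K L B) (hP : IsAdmissible c P) {η : ℝ} (hη : 0 ≤ η) :
    charSolution K P q 0 η = q η := by
  rw [charSolution, flow_self hK hP.1, hP.zero, label_of_nonpos hK hP (by linarith)]
  simp

/-- The boundary law for the rate, obtained by differentiating the fixed-point equation from the
right, since that formula holds only at nonnegative times. -/
theorem deriv_fixedPoint (hK : IsTame K L B) (hP : ContDiff ℝ 1 P)
    (hl : ContDiff ℝ 1 (label K P q)) (hfix : rateMap K q c P = P) {τ : ℝ} (hτ : 0 ≤ τ) :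
    deriv P τ = charSlope K P q (τ - 1) τ - K (q 1) := by
  have h1 := hasDerivAt_fixedPoint_aux hK hP.continuous
    (hl.differentiable one_ne_zero (τ - 1))
  have h2 : deriv P τ = _ := deriv_eq_of_eqOn_Ici (hP.differentiable one_ne_zero τ)
    h1.differentiableAt fun r (hr : τ ≤ r) => by
      rw [← rateMap_of_nonneg (c := c) (hτ.trans hr), hfix]
  have h3 := charSolution_outflow hfix hτ
  rw [charSolution] at h3
  rw [h2, h1.deriv, charSlope, h3]
  ring

/-- Equivalently, `charH` equals `P'` at the inlet, as it does at the outlet. -/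
theorem charSlope_inflow (hK : IsTame K L B) (hP : ContDiff ℝ 1 P)
    (hl : ContDiff ℝ 1 (label K P q)) (hq0 : q 0 = 0) {s : ℝ} (hs : 0 ≤ s) :
    charSlope K P q s s = K 0 + deriv P s := by
  have h1 := hasDerivAt_inlet hK hP.continuous (hP.differentiable one_ne_zero s).hasDerivAt
  have h2 : deriv (label K P q) s = _ := deriv_eq_of_eqOn_Ici
    (hl.differentiable one_ne_zero s) h1.differentiableAt fun r (hr : s ≤ r) =>
      label_of_nonneg hq0 (hs.trans hr)
  rw [charSlope, h2, h1.deriv, label_of_nonneg hq0 hs]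
  have := (flowRatio_pos K P s (inlet K P s) (inlet K P s)).ne'
  field_simp

theorem charSlope_initial (hK : IsTame K L B) (hq : ContDiff ℝ 1 q) (hP : IsAdmissible c P)
    (hl : ContDiff ℝ 1 (label K P q)) {s : ℝ} (hs : s ≤ 0) :
    charSlope K P q s 0 = deriv q (-s) := by
  rw [charSlope, flowRatio_zero, deriv_label_of_nonpos hK hq hP hs
    (hl.differentiable one_ne_zero s)]
  ring

theorem charSlope_pos_of_pos {s t r : ℝ} (h : 0 < charSlope K P q s t) :
    0 < charSlope K P q s r := by
  unfold charSlope at h ⊢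
  rw [← mul_neg] at h ⊢
  exact mul_pos (flowRatio_pos _ _ _ _ _) (pos_of_mul_pos_right h (flowRatio_pos _ _ _ _ _).le)

/-- `∂_η Q - K (Q)` along the characteristic with label `s`. -/
def charH (K P q : ℝ → ℝ) (s r : ℝ) : ℝ :=
  charSlope K P q s r - K (flow K P 0 (label K P q s) r + P r)

/-- Along a characteristic the slope has derivative `K'(Q)` times itself, while `K(Q)` has
derivative `K'(Q)(K(Q) + P')`; subtract. -/
theorem hasDerivAt_charH (hK : IsTame K L B) (hP : ContDiff ℝ 1 P) (s r : ℝ) :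
    HasDerivAt (charH K P q s) (deriv K (flow K P 0 (label K P q s) r + P r) *
      (charH K P q s r - deriv P r)) r := by
  have h1 := ((hasDerivAt_flowRatio hK hP.continuous (label K P q s) r).mul_const
    (deriv (label K P q) s)).neg
  have h2 := (hasDerivAt_flow hK hP.continuous 0 (label K P q s) r).add
    (hP.differentiable one_ne_zero r).hasDerivAt
  have h3 := (hK.contDiff.differentiable one_ne_zero
    (flow K P 0 (label K P q s) r + P r)).hasDerivAt.comp r h2
  refine (h1.sub h3).congr_deriv ?_
  simp only [charH, charSlope]
  ring

theorem fixedPoint_relaxation (hK : IsTame K L B) (hK' : ∀ x, deriv K x ≤ 0)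
    (hq : ContDiff ℝ 1 q) (hq0 : q 0 = 0) (hPa : IsAdmissible c P) (hP : ContDiff ℝ 1 P)
    (hl : ContDiff ℝ 1 (label K P q)) (hfix : rateMap K q c P = P) {τ : ℝ} (hτ : 0 < τ) :
    ∃ σ ∈ Ico 0 τ, ∃ g k : ℝ → ℝ, Continuous k ∧ (∀ r, k r ≤ 0) ∧
      (∀ r, HasDerivAt g (k r * (g r - deriv P r)) r) ∧ g τ = deriv P τ ∧
      ((∃ η ∈ Icc (0 : ℝ) 1, g σ = deriv q η - K (q η)) ∨ g σ = deriv P σ) := by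
  refine ⟨max (τ - 1) 0, ⟨le_max_right _ _, max_lt (by linarith) hτ⟩, charH K P q (τ - 1),
    fun r => deriv K (flow K P 0 (label K P q (τ - 1)) r + P r), ?_, fun r => hK' _,
    fun r => hasDerivAt_charH hK hP _ r, ?_, ?_⟩
  · exact (hK.contDiff.continuous_deriv le_rfl).comp
      ((continuous_flow_time hK hP.continuous _ _).add hP.continuous)
  · have h3 := charSolution_outflow hfix hτ.le
    rw [charSolution] at h3
    rw [charH, h3, deriv_fixedPoint hK hP hl hfix hτ.le]
  · rcases le_total τ 1 with h | h
    · left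
      refine ⟨-(τ - 1), ⟨by linarith, by linarith⟩, ?_⟩
      have hs : τ - 1 ≤ 0 := by linarith
      rw [max_eq_right hs, charH, charSlope_initial hK hq hPa hl hs, flow_self hK hPa.1,
        label_of_nonpos hK hPa hs, hPa.zero, add_zero]
    · right
      have hs : 0 ≤ τ - 1 := by linarith
      rw [max_eq_left hs, charH, charSlope_inflow hK hP hl hq0 hs, label_of_nonneg hq0 hs,
        flow_inlet hK hPa.1, neg_add_cancel]
      ring

theorem deriv_fixedPoint_mem_Icc (hK : IsTame K L B) (hK' : ∀ x, deriv K x ≤ 0)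
    (hq : ContDiff ℝ 1 q) (hq0 : q 0 = 0) (hPa : IsAdmissible c P) (hP : ContDiff ℝ 1 P)
    (hl : ContDiff ℝ 1 (label K P q)) (hfix : rateMap K q c P = P)
    (hc : c = deriv q 0 - K 0) {m M : ℝ}
    (hmM : ∀ η ∈ Icc (0 : ℝ) 1, deriv q η - K (q η) ∈ Icc m M) {τ : ℝ} (hτ : 0 ≤ τ) :
    deriv P τ ∈ Icc m M := by
  have hcont := hP.continuous_deriv le_rfl
  have h0 : deriv P 0 ∈ Icc m M := by
    rw [hPa.deriv_zero (hP.differentiable one_ne_zero 0), hc]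
    simpa [hq0] using hmM 0 (by simp)
  constructor
  -- The relaxation equation is linear, so the lower bound is the upper bound for `-P'`.
  · have := le_of_relaxation (h := fun t => -deriv P t) (M := -m) hcont.neg (neg_le_neg h0.1)
      (fun t ht => ?_) hτ
    · exact neg_le_neg_iff.1 this
    · obtain ⟨σ, hσ, g, k, hk, hk0, hg, hgt, hgσ⟩ :=
        fixedPoint_relaxation hK hK' hq hq0 hPa hP hl hfix ht
      refine ⟨σ, hσ, fun r => -g r, k, hk, hk0, fun r => (hg r).neg.congr_deriv (by ring),
        congrArg Neg.neg hgt, hgσ.imp ?_ (congrArg Neg.neg)⟩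
      rintro ⟨η, hη, h⟩
      beta_reduce
      rw [h]
      exact neg_le_neg (hmM η hη).1
  · refine le_of_relaxation hcont h0.2 (fun t ht => ?_) hτ
    obtain ⟨σ, hσ, g, k, hk, hk0, hg, hgt, hgσ⟩ :=
      fixedPoint_relaxation hK hK' hq hq0 hPa hP hl hfix ht
    refine ⟨σ, hσ, g, k, hk, hk0, hg, hgt, hgσ.imp ?_ id⟩
    rintro ⟨η, hη, h⟩
    rw [h]
    exact (hmM η hη).2

/-- The slope keeps its sign along a characteristic, so it suffices to look where the characteristic
starts: on the datum or at the inlet. Labels `s ≥ -1` cover the whole domain. -/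
theorem charSlope_pos (hK : IsTame K L B) (hK0 : 0 < K 0)
    (hq : ContDiff ℝ 1 q) (hq0 : q 0 = 0) (hq' : ∀ η ∈ Icc (0 : ℝ) 1, 0 < deriv q η)
    (hPa : IsAdmissible c P) (hP : ContDiff ℝ 1 P) (hl : ContDiff ℝ 1 (label K P q))
    (hP' : ∀ τ, 0 ≤ τ → 0 ≤ deriv P τ) {s : ℝ} (hs : -1 ≤ s) (r : ℝ) :
    0 < charSlope K P q s r := by
  rcases le_total s 0 with h | h
  · refine charSlope_pos_of_pos (t := 0) ?_
    rw [charSlope_initial hK hq hPa hl h]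
    exact hq' _ ⟨by linarith, by linarith⟩
  · refine charSlope_pos_of_pos (t := s) ?_
    rw [charSlope_inflow hK hP hl hq0 h]
    linarith [hP' s h]

end fixedPoint

section primitive

theorem hasDerivAt_primitive {g : ℝ → ℝ} (hg : Continuous g) (a x : ℝ) :
    HasDerivAt (fun x => a + ∫ u in (0 : ℝ)..x, g u) (g x) x :=
  (intervalIntegral.integral_hasDerivAt_right (hg.intervalIntegrable _ _)
    hg.aestronglyMeasurable.stronglyMeasurableAtFilter hg.continuousAt).const_add a

theorem contDiff_primitive {g : ℝ → ℝ} (hg : Continuous g) (a : ℝ) :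
    ContDiff ℝ 1 fun x => a + ∫ u in (0 : ℝ)..x, g u := by
  rw [contDiff_one_iff_deriv]
  refine ⟨fun x => (hasDerivAt_primitive hg a x).differentiableAt, ?_⟩
  rwa [show deriv _ = g from funext fun x => (hasDerivAt_primitive hg a x).deriv]

theorem primitive_eq_of_hasDerivAt {f g : ℝ → ℝ} (hg : Continuous g) {b x : ℝ}
    (hf : ContinuousOn f (Icc 0 b)) (hf' : ∀ y ∈ Ioo 0 b, HasDerivAt f (g y) y)
    (hx : x ∈ Icc 0 b) : f 0 + ∫ u in (0 : ℝ)..x, g u = f x := by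
  rw [intervalIntegral.integral_eq_sub_of_hasDerivAt_of_le hx.1
    (hf.mono (Icc_subset_Icc_right hx.2))
    (fun y hy => hf' y ⟨hy.1, hy.2.trans_le hx.2⟩) (hg.intervalIntegrable _ _)]
  ring

end primitive

/-! ### A bounded modification of `K` preserving the sign of `K'` -/

section truncation

variable {K : ℝ → ℝ} {ΦF : ℝ}

/-- The derivative of `K`, frozen and cut off outside of `[0, ΦF]`. -/
def cutDeriv (K : ℝ → ℝ) (ΦF u : ℝ) : ℝ :=
  deriv K (max 0 (min u ΦF)) * max 0 (1 - |u - max 0 (min u ΦF)|)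

/-- A bounded modification of `K` outside of `[0, ΦF]`. -/
def truncation (K : ℝ → ℝ) (ΦF x : ℝ) : ℝ := K 0 + ∫ u in (0 : ℝ)..x, cutDeriv K ΦF u

theorem continuous_cutDeriv (hK : ContDiff ℝ 1 K) (ΦF : ℝ) : Continuous (cutDeriv K ΦF) := by
  have := hK.continuous_deriv le_rfl
  unfold cutDeriv
  fun_prop

theorem deriv_truncation (hK : ContDiff ℝ 1 K) (x : ℝ) :
    deriv (truncation K ΦF) x = cutDeriv K ΦF x :=
  (hasDerivAt_primitive (continuous_cutDeriv hK ΦF) (K 0) x).deriv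

theorem cutDeriv_nonpos (hΦ : 0 ≤ ΦF) (hK' : ∀ φ ∈ Icc (0 : ℝ) ΦF, deriv K φ ≤ 0) (u : ℝ) :
    cutDeriv K ΦF u ≤ 0 :=
  mul_nonpos_of_nonpos_of_nonneg
    (hK' _ ⟨le_max_left _ _, max_le hΦ (min_le_right _ _)⟩) (le_max_left _ _)

theorem cutDeriv_of_mem {u : ℝ} (hu : u ∈ Icc 0 ΦF) : cutDeriv K ΦF u = deriv K u := by
  rw [cutDeriv, min_eq_left hu.2, max_eq_right hu.1]
  simp

theorem cutDeriv_of_le (hΦ : 0 ≤ ΦF) {u : ℝ} (hu : u ≤ -1) : cutDeriv K ΦF u = 0 := by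
  rw [cutDeriv, min_eq_left (by linarith), max_eq_left (by linarith), sub_zero,
    abs_of_nonpos (by linarith), max_eq_left (by linarith), mul_zero]

theorem cutDeriv_of_ge (hΦ : 0 ≤ ΦF) {u : ℝ} (hu : ΦF + 1 ≤ u) : cutDeriv K ΦF u = 0 := by
  rw [cutDeriv, min_eq_right (by linarith), max_eq_right (by linarith),
    abs_of_nonneg (by linarith), max_eq_left (by linarith : 1 - (u - ΦF) ≤ 0), mul_zero]

theorem truncation_of_mem (hK : ContDiff ℝ 1 K) {x : ℝ} (hx : x ∈ Icc 0 ΦF) :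
    truncation K ΦF x = K x :=
  primitive_eq_of_hasDerivAt (continuous_cutDeriv hK ΦF) hK.continuous.continuousOn
    (fun y hy => by
      rw [cutDeriv_of_mem (Ioo_subset_Icc_self hy)]
      exact (hK.differentiable one_ne_zero y).hasDerivAt) hx

theorem exists_isTame_truncation (hK : ContDiff ℝ 1 K) (hΦ : 0 ≤ ΦF) :
    ∃ L B : ℝ≥0, IsTame (truncation K ΦF) L B := by
  have hc := continuous_cutDeriv hK ΦF
  have hcd := contDiff_primitive hc (K 0)
  obtain ⟨C, hC⟩ := (isCompact_Icc (a := -1) (b := ΦF + 1)).exists_bound_of_continuousOn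
    hc.continuousOn
  obtain ⟨D, hD⟩ := (isCompact_Icc (a := -1) (b := ΦF + 1)).exists_bound_of_continuousOn
    (f := truncation K ΦF) hcd.continuous.continuousOn
  have hC0 : 0 ≤ C := (norm_nonneg _).trans (hC 0 ⟨by norm_num, by linarith⟩)
  have hD0 : 0 ≤ D := (norm_nonneg _).trans (hD 0 ⟨by norm_num, by linarith⟩)
  lift C to ℝ≥0 using hC0
  lift D to ℝ≥0 using hD0
  refine ⟨C, D, hcd, lipschitzWith_of_nnnorm_deriv_le
    (hcd.differentiable one_ne_zero) fun x => ?_, fun x => ?_⟩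
  · rw [← NNReal.coe_le_coe, coe_nnnorm]
    change ‖deriv (truncation K ΦF) x‖ ≤ C
    rw [deriv_truncation hK]
    rcases le_total x (-1) with h | h
    · rw [cutDeriv_of_le hΦ h, norm_zero]; exact C.2
    · rcases le_total x (ΦF + 1) with h' | h'
      · exact hC x ⟨h, h'⟩
      · rw [cutDeriv_of_ge hΦ h', norm_zero]; exact C.2
  · have key : ∀ y, (∀ u ∈ uIcc y x, cutDeriv K ΦF u = 0) →
        truncation K ΦF x = truncation K ΦF y := by
      intro y hy
      have h1 : ∫ u in y..x, cutDeriv K ΦF u = 0 := by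
        rw [intervalIntegral.integral_congr (g := fun _ => (0 : ℝ)) hy]
        simp
      have h2 := intervalIntegral.integral_add_adjacent_intervals
        (hc.intervalIntegrable 0 y) (hc.intervalIntegrable (μ := MeasureTheory.volume) y x)
      rw [truncation, truncation, ← h2, h1, add_zero]
    rcases le_total x (-1) with h | h
    · rw [key (-1) fun u hu => cutDeriv_of_le hΦ (by rw [uIcc_of_ge h] at hu; exact hu.2)]
      exact hD _ ⟨le_rfl, by linarith⟩
    · rcases le_total x (ΦF + 1) with h' | h'
      · exact hD x ⟨h, h'⟩
      · rw [key (ΦF + 1) fun u hu => cutDeriv_of_ge hΦ (by rw [uIcc_of_le h'] at hu; exact hu.1)]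
        exact hD _ ⟨by linarith, le_rfl⟩

end truncation

/-! ### Extension of the initial datum and global existence -/

section initialData

variable {K Qinit : ℝ → ℝ} {ΦF : ℝ}

theorem continuousOn_dEta (hQ : ContDiffOn ℝ 1 Qinit (Icc 0 1)) :
    ContinuousOn (dEta Qinit) (Icc 0 1) :=
  hQ.continuousOn_derivWithin (uniqueDiffOn_Icc zero_lt_one) le_rfl

/-- A `C¹` function on the line agrees with `f` to first order on `[0, 1]`. -/
theorem exists_contDiff_extension (hQ : ContDiffOn ℝ 1 Qinit (Icc 0 1)) :
    ∃ q : ℝ → ℝ, ContDiff ℝ 1 q ∧ ∀ η ∈ Icc (0 : ℝ) 1, q η = Qinit η ∧ deriv q η = dEta Qinit η := by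
  set g : ℝ → ℝ := IccExtend zero_le_one ((Icc (0 : ℝ) 1).domRestrict (dEta Qinit)) with hgdef
  have hg : Continuous g :=
    (continuousOn_iff_continuous_domRestrict.1 (continuousOn_dEta hQ)).Icc_extend'
  have hgm : ∀ η ∈ Icc (0 : ℝ) 1, g η = dEta Qinit η := fun η hη => by
    rw [hgdef, IccExtend_of_mem _ _ hη, domRestrict_apply]
  refine ⟨_, contDiff_primitive hg (Qinit 0), fun η hη => ⟨?_, ?_⟩⟩
  · refine primitive_eq_of_hasDerivAt hg hQ.continuousOn (fun y hy => ?_) hη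
    rw [hgm y (Ioo_subset_Icc_self hy)]
    exact ((hQ.differentiableOn one_ne_zero y (Ioo_subset_Icc_self hy)).hasDerivWithinAt).hasDerivAt
      (Icc_mem_nhds hy.1 hy.2)
  · rw [(hasDerivAt_primitive hg _ η).deriv, hgm η hη]

end initialData

theorem timeInterval_top : timeInterval ⊤ = Ici 0 := by
  ext τ
  simp [timeInterval, EReal.coe_lt_top]

theorem exists_global_solution {K Qinit : ℝ → ℝ} {ΦF : ℝ} (hΦF : 0 < ΦF)
    (hK : IsPhaseResponse K ΦF) (hK' : ∀ φ ∈ Icc (0 : ℝ) ΦF, deriv K φ ≤ 0)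
    (hQ : IsCompatibleInitialData K ΦF Qinit) {m M : ℝ} (hm : 0 < m)
    (hmM : ∀ η ∈ Icc (0 : ℝ) 1, Hinit K Qinit η ∈ Icc m M) :
    ∃ (Q : ℝ → ℝ → ℝ) (N : ℝ → ℝ), IsClassicalSolution K ΦF Qinit ⊤ Q N ∧
      ∀ τ, 0 ≤ τ → 1 / N τ ∈ Icc m M := by
  have hK1 : ContDiff ℝ 1 K := hK.contDiff.of_le one_le_two
  obtain ⟨L, B, hT⟩ := exists_isTame_truncation hK1 hΦF.le
  obtain ⟨q, hq, hqQ⟩ := exists_contDiff_extension hQ.contDiffOn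
  set T := truncation K ΦF with hTdef
  have hTK : ∀ x ∈ Icc 0 ΦF, T x = K x := fun x hx => truncation_of_mem hK1 hx
  have hT' : ∀ x, deriv T x ≤ 0 := fun x => by
    rw [hTdef, deriv_truncation hK1]; exact cutDeriv_nonpos hΦF.le hK' x
  have h0mem : (0 : ℝ) ∈ Icc 0 ΦF := ⟨le_rfl, hΦF.le⟩
  have hΦmem : ΦF ∈ Icc 0 ΦF := ⟨hΦF.le, le_rfl⟩
  have i0 : (0 : ℝ) ∈ Icc (0 : ℝ) 1 := by simp
  have i1 : (1 : ℝ) ∈ Icc (0 : ℝ) 1 := by simp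
  have hq0 : q 0 = 0 := by rw [(hqQ 0 i0).1, hQ.left]
  have hq1 : q 1 = ΦF := by rw [(hqQ 1 i1).1, hQ.right]
  have hqmem : ∀ η ∈ Icc (0 : ℝ) 1, q η ∈ Icc 0 ΦF := fun η hη => by
    rw [(hqQ η hη).1, ← hQ.left, ← hQ.right]
    exact ⟨hQ.mono i0 hη hη.1, hQ.mono hη i1 hη.2⟩
  have hqH : ∀ η ∈ Icc (0 : ℝ) 1, deriv q η - T (q η) = Hinit K Qinit η := fun η hη => by
    rw [hTK _ (hqmem η hη), (hqQ η hη).1, (hqQ η hη).2, Hinit]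
  have hqpos : ∀ η ∈ Icc (0 : ℝ) 1, 0 < deriv q η := fun η hη => by
    have h1 := hqH η hη
    rw [hTK _ (hqmem η hη)] at h1
    linarith [hK.pos _ (hqmem η hη), (hmM η hη).1]
  set c := deriv q 0 - T 0 with hc0
  have hc1 : c = deriv q 1 - T (q 1) := by
    have := hQ.compat
    rw [hc0, hq1, hTK _ h0mem, hTK _ hΦmem, (hqQ 0 i0).2, (hqQ 1 i1).2]
    linarith
  obtain ⟨P, hPa, hfix⟩ := exists_fixedPoint_rateMap hT hq.continuous hq0 c
  obtain ⟨hP, hl⟩ := contDiff_fixedPoint hT hq hPa hfix hc0 hc1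
  have hrate : ∀ τ, 0 ≤ τ → deriv P τ ∈ Icc m M := fun τ hτ =>
    deriv_fixedPoint_mem_Icc hT hT' hq hq0 hPa hP hl hfix hc0
      (fun η hη => by rw [hqH η hη]; exact hmM η hη) hτ
  have hslope : ∀ τ, 0 ≤ τ → ∀ η ∈ Icc (0 : ℝ) 1, 0 < charSlope T P q (τ - η) τ :=
    fun τ hτ η hη => charSlope_pos hT (by rw [hTK _ h0mem]; exact hK.pos _ h0mem) hq hq0 hqpos
      hPa hP hl (fun τ hτ => hm.le.trans (hrate τ hτ).1) (by linarith [hη.2]) τ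
  set Q := charSolution T P q with hQdef
  have hspace := hasDerivAt_charSolution_space hT hP hl
  have hin : ∀ τ, 0 ≤ τ → Q τ 0 = 0 := fun τ hτ => charSolution_inflow hT hPa.1 hq0 hτ
  have hout : ∀ τ, 0 ≤ τ → Q τ 1 = ΦF := fun τ hτ => by
    rw [hQdef, charSolution_outflow hfix hτ, hq1]
  have hmono : ∀ τ, 0 ≤ τ → MonotoneOn (Q τ) (Icc 0 1) := fun τ hτ => by
    refine monotoneOn_of_deriv_nonneg (convex_Icc _ _)
      (fun η _ => (hspace τ η).continuousAt.continuousWithinAt)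
      (fun η _ => (hspace τ η).differentiableAt.differentiableWithinAt) fun η hη => ?_
    rw [(hspace τ η).deriv]
    exact (hslope τ hτ η (interior_subset hη)).le
  -- Monotonicity and the two boundary values trap `Q` where `T` and `K` agree, so the truncation is
  -- removed.
  have hQmem : ∀ τ, 0 ≤ τ → ∀ η ∈ Icc (0 : ℝ) 1, Q τ η ∈ Icc 0 ΦF := fun τ hτ η hη =>
    ⟨(hin τ hτ).ge.trans (hmono τ hτ i0 hη hη.1), (hmono τ hτ hη i1 hη.2).trans (hout τ hτ).le⟩
  have hdEta : ∀ τ, ∀ η ∈ Icc (0 : ℝ) 1, dEta (Q τ) η = charSlope T P q (τ - η) τ :=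
    fun τ η hη => (hspace τ η).hasDerivWithinAt.derivWithin (uniqueDiffOn_Icc zero_lt_one η hη)
  have hend : ∀ τ, 0 ≤ τ → deriv P τ = dEta (Q τ) 1 - K ΦF := fun τ hτ => by
    rw [hdEta τ 1 i1, deriv_fixedPoint hT hP hl hfix hτ, hq1, hTK _ hΦmem]
  refine ⟨Q, fun τ => 1 / deriv P τ, ?_, fun τ hτ => by rw [one_div_one_div]; exact hrate τ hτ⟩
  constructor
  · exact EReal.coe_lt_top 0
  · exact (contDiff_charSolution hT hP hl).contDiffOn
  · rwa [timeInterval_top]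
  · rw [timeInterval_top]
    exact continuousOn_const.div (hP.continuous_deriv le_rfl).continuousOn
      fun τ hτ => (hm.trans_le (hrate τ hτ).1).ne'
  · rw [timeInterval_top]
    exact fun τ hτ => one_div_pos.2 (hm.trans_le (hrate τ hτ).1)
  · rw [timeInterval_top]
    intro τ hτ η hη
    have hη' := Ioo_subset_Icc_self hη
    rw [(hasDerivAt_charSolution_time hT hP hl τ η).hasDerivWithinAt.derivWithin
      (uniqueDiffOn_Ici 0 τ hτ), hdEta τ η hη', one_div_one_div, ← hTK _ (hQmem τ hτ η hη')]
    ring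
  · rwa [timeInterval_top]
  · rw [timeInterval_top]
    intro τ hτ
    rw [one_div_one_div]
    exact hend τ hτ
  · intro η hη
    rw [hQdef, charSolution_initial hT hPa hη.1, (hqQ η hη).1]
  · rw [timeInterval_top]
    intro τ hτ
    linarith [hend τ hτ, (hrate τ hτ).1]

/-! ### Uniqueness for arbitrary classical solutions, with the original `K` -/

theorem uniqueDiffOn_timeInterval {T : EReal} (hT : 0 < T) : UniqueDiffOn ℝ (timeInterval T) := by
  have hconv : Convex ℝ (timeInterval T) := by
    refine (ordConnected_iff.2 fun x hx y hy _ z hz => ?_).convex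
    exact ⟨hx.1.trans hz.1, (EReal.coe_le_coe_iff.2 hz.2).trans_lt hy.2⟩
  refine uniqueDiffOn_convex hconv ?_
  obtain ⟨t, ht0, htT⟩ := EReal.lt_iff_exists_real_btwn.1 hT
  have ht0' : 0 < t := by exact_mod_cast ht0
  have hsub : Ioo 0 t ⊆ timeInterval T := fun r hr =>
    ⟨hr.1.le, (EReal.coe_lt_coe_iff.2 hr.2).trans htT⟩
  exact ⟨t / 2, interior_maximal hsub isOpen_Ioo ⟨by linarith, by linarith⟩⟩

theorem mem_timeInterval_of_le {T : EReal} {r τ : ℝ} (hτ : τ ∈ timeInterval T) (h0 : 0 ≤ r)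
    (hr : r ≤ τ) : r ∈ timeInterval T :=
  ⟨h0, (EReal.coe_le_coe_iff.2 hr).trans_lt hτ.2⟩

theorem IsPhaseResponse.exists_lipschitz {K : ℝ → ℝ} {ΦF : ℝ} (hK : IsPhaseResponse K ΦF) :
    ∃ L : ℝ≥0, LipschitzWith L K := by
  obtain ⟨C, hC⟩ := hK.bounded_deriv
  have hC0 : 0 ≤ C := (abs_nonneg _).trans (hC 0)
  lift C to ℝ≥0 using hC0
  exact ⟨C, lipschitzWith_of_nnnorm_deriv_le
    (hK.contDiff.differentiable two_ne_zero) fun x => hC x⟩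

namespace IsClassicalSolution

variable {K Qinit N : ℝ → ℝ} {ΦF : ℝ} {T : EReal} {Q : ℝ → ℝ → ℝ}

/-- The total derivative of `Q` on the closed domain. -/
def fderivQ (T : EReal) (Q : ℝ → ℝ → ℝ) : ℝ × ℝ → ℝ × ℝ →L[ℝ] ℝ :=
  fderivWithin ℝ (fun p : ℝ × ℝ => Q p.1 p.2) (timeInterval T ×ˢ Icc (0 : ℝ) 1)

theorem hasFDerivWithinAt (h : IsClassicalSolution K ΦF Qinit T Q N) {τ η : ℝ}
    (hτ : τ ∈ timeInterval T) (hη : η ∈ Icc (0 : ℝ) 1) :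
    HasFDerivWithinAt (fun p : ℝ × ℝ => Q p.1 p.2) (fderivQ T Q (τ, η))
      (timeInterval T ×ˢ Icc (0 : ℝ) 1) (τ, η) :=
  (h.contDiffOn.differentiableOn one_ne_zero (τ, η) ⟨hτ, hη⟩).hasFDerivWithinAt

theorem hasDerivWithinAt_comp (h : IsClassicalSolution K ΦF Qinit T Q N) {α β : ℝ → ℝ}
    {a b r : ℝ} {s : Set ℝ} (hα : HasDerivWithinAt α a s r) (hβ : HasDerivWithinAt β b s r)
    (hrs : r ∈ s) (hαs : ∀ r ∈ s, α r ∈ timeInterval T) (hβs : ∀ r ∈ s, β r ∈ Icc (0 : ℝ) 1) :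
    HasDerivWithinAt (fun r => Q (α r) (β r)) (fderivQ T Q (α r, β r) (a, b)) s r :=
  HasFDerivWithinAt.comp_hasDerivWithinAt (f := fun r => (α r, β r)) r
    (h.hasFDerivWithinAt (hαs r hrs) (hβs r hrs))
    (hα.prodMk hβ) fun r hr => ⟨hαs r hr, hβs r hr⟩

theorem dEta_eq (h : IsClassicalSolution K ΦF Qinit T Q N) {τ η : ℝ}
    (hτ : τ ∈ timeInterval T) (hη : η ∈ Icc (0 : ℝ) 1) :
    dEta (Q τ) η = fderivQ T Q (τ, η) (0, 1) :=
  (h.hasDerivWithinAt_comp (hasDerivWithinAt_const _ _ τ) (hasDerivWithinAt_id _ _) hη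
    (fun _ _ => hτ) fun _ hr => hr).derivWithin (uniqueDiffOn_Icc zero_lt_one η hη)

/-- Both sides are continuous in `η` up to the end points, so the equation passes from `(0, 1)` to
its closure. -/
theorem transport_closed (hK : Continuous K) (h : IsClassicalSolution K ΦF Qinit T Q N) {τ η : ℝ}
    (hτ : τ ∈ timeInterval T) (hη : η ∈ Icc (0 : ℝ) 1) :
    fderivQ T Q (τ, η) (1, 1) = 1 / N τ + K (Q τ η) := by
  have hU := uniqueDiffOn_timeInterval h.time_pos
  have hmaps : MapsTo (fun η : ℝ => (τ, η)) (Icc 0 1) (timeInterval T ×ˢ Icc (0 : ℝ) 1) :=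
    fun η hη => ⟨hτ, hη⟩
  have hpair : ContinuousOn (fun η : ℝ => (τ, η)) (Icc 0 1) := by fun_prop
  have hcf : ContinuousOn (fun η => fderivQ T Q (τ, η)) (Icc 0 1) :=
    ContinuousOn.comp (g := fderivQ T Q) (h.contDiffOn.continuousOn_fderivWithin
      (hU.prod (uniqueDiffOn_Icc zero_lt_one)) le_rfl) hpair hmaps
  have hcQ : ContinuousOn (fun η => Q τ η) (Icc 0 1) :=
    ContinuousOn.comp (g := fun p : ℝ × ℝ => Q p.1 p.2) h.contDiffOn.continuousOn hpair hmaps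
  refine Set.EqOn.of_subset_closure (s := Ioo (0 : ℝ) 1) (t := Icc (0 : ℝ) 1)
    (f := fun η => fderivQ T Q (τ, η) (1, 1)) (g := fun η => 1 / N τ + K (Q τ η))
    (fun η hη => ?_) (hcf.clm_apply continuousOn_const)
    (continuousOn_const.add (hK.comp_continuousOn hcQ)) Ioo_subset_Icc_self
    (closure_Ioo zero_ne_one).ge hη
  have hη' := Ioo_subset_Icc_self hη
  have h1 := (h.hasDerivWithinAt_comp (hasDerivWithinAt_id τ _) (hasDerivWithinAt_const _ _ η) hτ
    (fun _ hr => hr) fun _ _ => hη').derivWithin (hU τ hτ)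
  have h2 := h.transport τ hτ η hη
  rw [h.dEta_eq hτ hη'] at h2
  simp only [id] at h1
  rw [h1, ← map_add] at h2
  simpa using h2

/-- At `η = 1` the rate law cancels both `1/N` and the `η`-derivative. What remains is `y' = K(y) -
K(ΦF)`, with `ΦF` as its stationary solution. -/
theorem outflow {L : ℝ≥0} (hK : LipschitzWith L K) (hQ1 : Qinit 1 = ΦF)
    (h : IsClassicalSolution K ΦF Qinit T Q N) {τ : ℝ} (hτ : τ ∈ timeInterval T) :
    Q τ 1 = ΦF := by
  have i1 : (1 : ℝ) ∈ Icc (0 : ℝ) 1 := by simp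
  have hmem : ∀ r ∈ Icc 0 τ, r ∈ timeInterval T := fun r hr => mem_timeInterval_of_le hτ hr.1 hr.2
  have hd : ∀ r ∈ Icc 0 τ, HasDerivWithinAt (fun r => Q r 1) (K (Q r 1) - K ΦF) (Icc 0 τ) r := by
    intro r hr
    refine (h.hasDerivWithinAt_comp (hasDerivWithinAt_id r _) (hasDerivWithinAt_const _ _ 1) hr
      hmem fun _ _ => i1).congr_deriv ?_
    have e1 := h.transport_closed hK.continuous (hmem r hr) i1
    have e2 := h.rate_eq r (hmem r hr)
    rw [h.dEta_eq (hmem r hr) i1] at e2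
    have e3 : fderivQ T Q (r, 1) (1, 1) =
        fderivQ T Q (r, 1) (1, 0) + fderivQ T Q (r, 1) (0, 1) := by
      rw [← map_add]; simp
    simp only [id]
    linarith
  have := ODE_solution_unique (v := fun _ y => K y - K ΦF) (K := L) (f := fun r => Q r 1)
    (g := fun _ => ΦF) (a := 0) (b := τ)
    (fun _ => LipschitzWith.of_dist_le_mul fun x y => by
      simpa only [dist_sub_right] using hK.dist_le_mul x y)
    (fun r hr => (hd r hr).continuousWithinAt)
    (fun r hr => (hd r (Ico_subset_Icc_self hr)).mono_of_mem_nhdsWithin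
      (Icc_mem_nhdsGE_of_mem hr)) continuousOn_const
    (fun r _ => by simpa using hasDerivWithinAt_const r (Ici r) ΦF)
    (by rw [h.initial 1 i1, hQ1])
  exact this (right_mem_Icc.2 hτ.1)

/-- `Q - P` solves `z' = K (z + P)` along characteristics, where `P' = 1 / N`. -/
theorem hasDerivWithinAt_characteristic (hK : Continuous K)
    (h : IsClassicalSolution K ΦF Qinit T Q N) {τ σ s : ℝ} (hτ : τ ∈ timeInterval T)
    (hσ : 0 ≤ σ) (hs : s ≤ σ) (hsτ : τ - s ≤ 1) {P : ℝ → ℝ}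
    (hP : ∀ r ∈ Icc 0 τ, HasDerivAt P (1 / N r) r) {r : ℝ} (hr : r ∈ Icc σ τ) :
    HasDerivWithinAt (fun r => Q r (r - s) - P r) (K (Q r (r - s) - P r + P r)) (Icc σ τ) r := by
  have hmem : ∀ r ∈ Icc σ τ, r ∈ timeInterval T := fun r hr =>
    mem_timeInterval_of_le hτ (hσ.trans hr.1) hr.2
  have hmem' : ∀ r ∈ Icc σ τ, r - s ∈ Icc (0 : ℝ) 1 := fun r hr =>
    ⟨by linarith [hr.1], by linarith [hr.2]⟩
  refine ((h.hasDerivWithinAt_comp (hasDerivWithinAt_id r _)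
    ((hasDerivWithinAt_id r _).sub_const s) hr hmem hmem').sub
      (hP r ⟨hσ.trans hr.1, hr.2⟩).hasDerivWithinAt).congr_deriv ?_
  simp only [id]
  rw [h.transport_closed hK (hmem r hr) (hmem' r hr), sub_add_cancel]
  ring

theorem exists_primitive (h : IsClassicalSolution K ΦF Qinit T Q N) {τ : ℝ}
    (hτ : τ ∈ timeInterval T) :
    ∃ P : ℝ → ℝ, P 0 = 0 ∧ Continuous P ∧ ∀ r ∈ Icc 0 τ, HasDerivAt P (1 / N r) r := by
  have hc : ContinuousOn (fun r => 1 / N r) (Icc 0 τ) :=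
    (continuousOn_const.div h.rate_cont fun r hr => (h.rate_pos r hr).ne').mono
      fun r hr => mem_timeInterval_of_le hτ hr.1 hr.2
  -- Freezing `1/N` outside `[0, τ]` gives two-sided derivatives of its primitive even at the end
  -- points.
  set n := IccExtend hτ.1 ((Icc 0 τ).domRestrict fun r => 1 / N r) with hn
  have hnc : Continuous n := (continuousOn_iff_continuous_domRestrict.1 hc).Icc_extend'
  refine ⟨_, ?_, (contDiff_primitive hnc 0).continuous, fun r hr => ?_⟩
  · simp
  · have := hasDerivAt_primitive hnc 0 r
    rwa [hn, IccExtend_of_mem _ _ hr, domRestrict_apply] at this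

variable {Q₁ Q₂ : ℝ → ℝ → ℝ} {N₁ N₂ P₁ P₂ : ℝ → ℝ} {T₁ T₂ : EReal}

/-- By `outflow`, `P₁` and `P₂` satisfy the same delayed equation. Iterating the contraction halves
the weighted gap indefinitely. -/
theorem primitive_unique {L : ℝ≥0} (hK : LipschitzWith L K) (hQ1 : Qinit 1 = ΦF)
    (h₁ : IsClassicalSolution K ΦF Qinit T₁ Q₁ N₁) (h₂ : IsClassicalSolution K ΦF Qinit T₂ Q₂ N₂)
    {τ : ℝ} (hτ₁ : τ ∈ timeInterval T₁) (hτ₂ : τ ∈ timeInterval T₂)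
    (hP₁0 : P₁ 0 = 0) (hP₂0 : P₂ 0 = 0) (hP₁c : Continuous P₁) (hP₂c : Continuous P₂)
    (hP₁ : ∀ r ∈ Icc 0 τ, HasDerivAt P₁ (1 / N₁ r) r)
    (hP₂ : ∀ r ∈ Icc 0 τ, HasDerivAt P₂ (1 / N₂ r) r) :
    EqOn P₁ P₂ (Icc 0 τ) := by
  set lam : ℝ := 5 * L + 5 with hlam
  have hlam0 : 0 ≤ lam := by positivity
  obtain ⟨C, hC⟩ := (isCompact_Icc (a := (0 : ℝ)) (b := τ)).exists_bound_of_continuousOn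
    (hP₁c.sub hP₂c).continuousOn
  set A := |C| + 1 with hA
  have key : ∀ n : ℕ, ∀ t ∈ Icc 0 τ, |P₁ t - P₂ t| ≤ A / 2 ^ n * Real.exp (lam * t) := by
    intro n
    induction n with
    | zero =>
      intro t ht
      rw [pow_zero, div_one]
      have h1 : |P₁ t - P₂ t| ≤ A := (hC t ht).trans (by linarith [le_abs_self C])
      exact h1.trans (le_mul_of_one_le_right (by positivity)
        (Real.one_le_exp (mul_nonneg hlam0 ht.1)))
    | succ n ih =>
      intro t ht
      set σ := max (t - 1) 0 with hσ
      have hσ0 : 0 ≤ σ := le_max_right _ _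
      have hσ1 : t - 1 ≤ σ := le_max_left _ _
      have ht₁ := mem_timeInterval_of_le hτ₁ ht.1 ht.2
      have ht₂ := mem_timeInterval_of_le hτ₂ ht.1 ht.2
      have hsub : Icc 0 t ⊆ Icc 0 τ := Icc_subset_Icc_right ht.2
      have hd₁ := fun r hr => h₁.hasDerivWithinAt_characteristic hK.continuous ht₁ hσ0 hσ1
        (by linarith) (fun r hr => hP₁ r (hsub hr)) (r := r) hr
      have hd₂ := fun r hr => h₂.hasDerivWithinAt_characteristic hK.continuous ht₂ hσ0 hσ1
        (by linarith) (fun r hr => hP₂ r (hsub hr)) (r := r) hr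
      have := abs_sub_le_half_of_trajectories (P₁ := P₁) (P₂ := P₂) (A := A / 2 ^ n) hK
        (by positivity) hlam.ge hσ ht.1
        (fun r hr => (hd₁ r hr).continuousWithinAt) (fun r hr => (hd₂ r hr).continuousWithinAt)
        (fun r hr => (hd₁ r (Ico_subset_Icc_self hr)).mono_of_mem_nhdsWithin
          (Icc_mem_nhdsGE_of_mem hr))
        (fun r hr => (hd₂ r (Ico_subset_Icc_self hr)).mono_of_mem_nhdsWithin
          (Icc_mem_nhdsGE_of_mem hr))
        (fun r hr => ih r ⟨hσ0.trans hr.1, hr.2.trans ht.2⟩) (fun h1 => ?_) (fun h1 => ?_)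
      · simp only [sub_sub_cancel] at this
        rw [h₁.outflow hK hQ1 ht₁, h₂.outflow hK hQ1 ht₂, sub_sub_sub_cancel_left,
          abs_sub_comm] at this
        refine this.trans_eq ?_
        rw [pow_succ, ← div_div]
      · have hσ' : σ = 0 := max_eq_right (by linarith)
        have hmem : (0 : ℝ) - (t - 1) ∈ Icc (0 : ℝ) 1 := ⟨by linarith, by linarith [ht.1]⟩
        simp only [hσ', hP₁0, hP₂0]
        rw [h₁.initial _ hmem, h₂.initial _ hmem]
      · have hσ' : σ = t - 1 := max_eq_left (by linarith)
        have hσm : σ ∈ Icc 0 τ := ⟨hσ0, by linarith [ht.2]⟩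
        have := ih σ hσm
        simp only [← hσ', sub_self]
        rw [h₁.inflow σ (mem_timeInterval_of_le hτ₁ hσ0 hσm.2),
          h₂.inflow σ (mem_timeInterval_of_le hτ₂ hσ0 hσm.2), sub_sub_sub_cancel_left,
          abs_sub_comm]
        exact this
  intro t ht
  have hlim : Tendsto (fun n : ℕ => A / 2 ^ n * Real.exp (lam * t)) atTop (𝓝 0) := by
    have := (tendsto_pow_atTop_nhds_zero_of_lt_one (r := (1 / 2 : ℝ)) (by norm_num)
      (by norm_num)).const_mul (A * Real.exp (lam * t))
    rw [mul_zero] at this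
    refine this.congr fun n => ?_
    rw [one_div, inv_pow]
    ring
  have := ge_of_tendsto' hlim fun n => key n t ht
  exact sub_eq_zero.1 (abs_eq_zero.1 (this.antisymm (abs_nonneg _)))

/-- Once the primitives agree, both solutions obey one differential equation along the
characteristic through `(τ, η)`, with the same starting value. The rate is then read off from the
slope at `η = 1`. -/
theorem unique (hK : IsPhaseResponse K ΦF) (hQ1 : Qinit 1 = ΦF)
    (h₁ : IsClassicalSolution K ΦF Qinit T₁ Q₁ N₁) (h₂ : IsClassicalSolution K ΦF Qinit T₂ Q₂ N₂)
    {τ : ℝ} (hτ₁ : τ ∈ timeInterval T₁) (hτ₂ : τ ∈ timeInterval T₂) :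
    N₁ τ = N₂ τ ∧ ∀ η ∈ Icc (0 : ℝ) 1, Q₁ τ η = Q₂ τ η := by
  obtain ⟨L, hL⟩ := hK.exists_lipschitz
  suffices hQ : EqOn (Q₁ τ) (Q₂ τ) (Icc 0 1) by
    refine ⟨?_, hQ⟩
    have e₁ := h₁.rate_eq τ hτ₁
    rw [dEta, derivWithin_congr hQ (hQ (by simp)), ← dEta, ← h₂.rate_eq τ hτ₂] at e₁
    simpa using e₁
  intro η hη
  obtain ⟨P₁, hP₁0, hP₁c, hP₁⟩ := h₁.exists_primitive hτ₁
  obtain ⟨P₂, hP₂0, hP₂c, hP₂⟩ := h₂.exists_primitive hτ₂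
  have hP := primitive_unique hL hQ1 h₁ h₂ hτ₁ hτ₂ hP₁0 hP₂0 hP₁c hP₂c hP₁ hP₂
  set σ := max (τ - η) 0 with hσ
  have hσ0 : 0 ≤ σ := le_max_right _ _
  have hσ1 : τ - η ≤ σ := le_max_left _ _
  have hστ : σ ≤ τ := max_le (by linarith [hη.1]) hτ₁.1
  have hd₁ := fun r hr => h₁.hasDerivWithinAt_characteristic hL.continuous hτ₁ hσ0 hσ1
    (by linarith [hη.2]) hP₁ (r := r) hr
  have hd₂ := fun r hr => h₂.hasDerivWithinAt_characteristic hL.continuous hτ₂ hσ0 hσ1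
    (by linarith [hη.2]) hP₂ (r := r) hr
  have hz := ODE_solution_unique (v := fun t y => K (y + P₁ t)) (a := σ) (b := τ)
    (fun t => lipschitzWith_comp_add_const hL (P₁ t))
    (fun r hr => (hd₁ r hr).continuousWithinAt)
    (fun r hr => (hd₁ r (Ico_subset_Icc_self hr)).mono_of_mem_nhdsWithin
      (Icc_mem_nhdsGE_of_mem hr))
    (fun r hr => (hd₂ r hr).continuousWithinAt)
    (fun r hr => by
      have hr' := Ico_subset_Icc_self hr
      rw [hP ⟨hσ0.trans hr'.1, hr'.2⟩]
      exact (hd₂ r hr').mono_of_mem_nhdsWithin (Icc_mem_nhdsGE_of_mem hr)) ?_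
    (right_mem_Icc.2 hστ)
  · simp only [sub_sub_cancel, hP (right_mem_Icc.2 hτ₁.1)] at hz
    linarith
  · rw [hP ⟨hσ0, hστ⟩]
    congr 1
    rcases le_total τ η with h | h
    · have hσ' : σ = 0 := max_eq_right (by linarith)
      have hmem : (0 : ℝ) - (τ - η) ∈ Icc (0 : ℝ) 1 :=
        ⟨by linarith, by linarith [hη.2, hτ₁.1]⟩
      rw [hσ', h₁.initial _ hmem, h₂.initial _ hmem]
    · have hσ' : σ = τ - η := max_eq_left (by linarith)
      rw [← hσ', sub_self, h₁.inflow σ (mem_timeInterval_of_le hτ₁ hσ0 hστ),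
        h₂.inflow σ (mem_timeInterval_of_le hτ₂ hσ0 hστ)]

end IsClassicalSolution

end PulseCoupled

end

/-! ### The main theorem, with the extrema of `Hinit` attained by compactness -/

theorem theorem5p1 (K : ℝ → ℝ) (ΦF : ℝ) (hΦF : 0 < ΦF)
    (hK : PulseCoupled.IsPhaseResponse K ΦF)
    (hK' : ∀ φ ∈ Set.Icc (0 : ℝ) ΦF, deriv K φ ≤ 0)
    (Qinit : ℝ → ℝ) (hQ : PulseCoupled.IsCompatibleInitialData K ΦF Qinit)
    (hH : ∀ η ∈ Set.Icc (0 : ℝ) 1, 0 < PulseCoupled.Hinit K Qinit η) :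
    ∃ (Q : ℝ → ℝ → ℝ) (N : ℝ → ℝ),
      -- a global classical solution exists
      PulseCoupled.IsClassicalSolution K ΦF Qinit ⊤ Q N ∧
      -- every classical solution, on any interval `[0, T)`, coincides with it there
      (∀ (T : EReal) (Q' : ℝ → ℝ → ℝ) (N' : ℝ → ℝ),
        PulseCoupled.IsClassicalSolution K ΦF Qinit T Q' N' →
          ∀ τ ∈ PulseCoupled.timeInterval T,
            N' τ = N τ ∧ ∀ η ∈ Set.Icc (0 : ℝ) 1, Q' τ η = Q τ η) ∧
      -- global bounds through the minimum `m` and the maximum `M` of `Hinit` over `[0, 1]`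
      ∃ m M : ℝ,
        IsLeast (PulseCoupled.Hinit K Qinit '' Set.Icc (0 : ℝ) 1) m ∧
        IsGreatest (PulseCoupled.Hinit K Qinit '' Set.Icc (0 : ℝ) 1) M ∧
        0 < m ∧ 0 < 1 / M ∧
        ∀ τ : ℝ, 0 ≤ τ → 1 / M ≤ N τ ∧ N τ ≤ 1 / m := by
  have i0 : (0 : ℝ) ∈ Set.Icc (0 : ℝ) 1 := by simp
  have hcont : ContinuousOn (PulseCoupled.Hinit K Qinit) (Set.Icc 0 1) :=
    (PulseCoupled.continuousOn_dEta hQ.contDiffOn).sub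
      (hK.contDiff.continuous.comp_continuousOn hQ.contDiffOn.continuousOn)
  obtain ⟨ηm, hηm, hm⟩ := isCompact_Icc.exists_isMinOn ⟨0, i0⟩ hcont
  obtain ⟨ηM, hηM, hM⟩ := isCompact_Icc.exists_isMaxOn ⟨0, i0⟩ hcont
  have hm0 := hH ηm hηm
  have hM0 := hH ηM hηM
  obtain ⟨Q, N, hsol, hN⟩ := PulseCoupled.exists_global_solution hΦF hK hK' hQ hm0
    fun η hη => ⟨isMinOn_iff.1 hm η hη, isMaxOn_iff.1 hM η hη⟩
  refine ⟨Q, N, hsol, fun T Q' N' h' τ hτ => ?_, _, _,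
    ⟨Set.mem_image_of_mem _ hηm, Set.forall_mem_image.2 (isMinOn_iff.1 hm)⟩,
    ⟨Set.mem_image_of_mem _ hηM, Set.forall_mem_image.2 (isMaxOn_iff.1 hM)⟩,
    hm0, one_div_pos.2 hM0, fun τ hτ => ?_⟩
  · exact h'.unique hK hQ.right hsol hτ ⟨hτ.1, EReal.coe_lt_top τ⟩
  · have h1 := hN τ hτ
    have h2 : N τ = 1 / (1 / N τ) := (one_div_one_div _).symm
    rw [h2]
    exact ⟨one_div_le_one_div_of_le (hm0.trans_le h1.1) h1.2, one_div_le_one_div_of_le hm0 h1.1⟩
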